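/- Let $T>0$, let $Q_T=(0,1)\times(0,T)$, and let $0<b_0<b_1$. Let $b\in C^1(\overline{Q}_T)$ satisfy $\|b\|_{C^1(\overline{Q}_T)}\le b_1$ and $b(x,t)\ge b_0$ in $Q_T$. Let $\psi_0,\psi_1\in H^2(0,T)$, identified with their representatives that are continuous on $[0,T]$. Then there is at most one function $v\in H^2(Q_T)$ (up to equality almost everywhere in $Q_T$) such that $$v_t+b(x,t)\,v_{xx}=0\quad\text{a.e. in }Q_T,$$ $$v(0,t)=\psi_0(t),\qquad v(1,t)=\psi_1(t),\qquad t\in(0,T),$$ $$v(x,0)=\psi_0(0)(1-x)+\psi_1(0)\,x,\qquad x\in(0,1),$$ where the derivatives are weak derivatives and the boundary and initial values are understood in the sense of traces. -/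

import Mathlib

open MeasureTheory Set Filter Topology
open scoped ENNReal ContDiff

namespace BackwardParabolic

section Sobolev

variable {E : Type*} [NormedAddCommGroup E] [NormedSpace ℝ E] [MeasureSpace E]

/-- `g` is the weak derivative of `u` in the direction `e` in the open set `Ω`: both functions are
locally integrable in `Ω`, and `∫_Ω u ∂_e φ = - ∫_Ω g φ` for every `φ ∈ C_c^∞(Ω)`. -/
def HasWeakDeriv (Ω : Set E) (e : E) (u g : E → ℝ) : Prop :=
  LocallyIntegrableOn u Ω ∧ LocallyIntegrableOn g Ω ∧
    ∀ φ : E → ℝ, ContDiff ℝ ∞ φ → HasCompactSupport φ → tsupport φ ⊆ Ω →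
      ∫ x in Ω, u x * fderiv ℝ φ x e = - ∫ x in Ω, g x * φ x

/-- `u ∈ H²(Ω)`: `u` and all its weak derivatives of order one and two lie in `L²(Ω)`. -/
def MemH2 (Ω : Set E) (u : E → ℝ) : Prop :=
  MemLp u 2 (volume.restrict Ω) ∧
    ∀ e : E, ∃ g : E → ℝ, HasWeakDeriv Ω e u g ∧ MemLp g 2 (volume.restrict Ω) ∧
      ∀ e' : E, ∃ h : E → ℝ, HasWeakDeriv Ω e' g h ∧ MemLp h 2 (volume.restrict Ω)

end Sobolev

/-- The open rectangle `Q_T = (0,1) × (0,T)`; a point is `p = (x, t)`. -/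
def Q (T : ℝ) : Set (ℝ × ℝ) := Ioo 0 1 ×ˢ Ioo 0 T

/-- The closed rectangle `[0,1] × [0,T]`, the closure of `Q_T` when `T > 0`. -/
def Qbar (T : ℝ) : Set (ℝ × ℝ) := Icc 0 1 ×ˢ Icc 0 T

/-- `b ∈ C¹(Q̄_T)` and `‖b‖_{C¹(Q̄_T)} ≤ M`, where the `C¹` norm is the largest of the suprema over
`Q̄_T` of `|b|`, `|b_x|`, `|b_t|`. (If the sum of the three suprema is at most `M`, then this
condition holds too.) -/
def C1NormLE (T : ℝ) (b : ℝ × ℝ → ℝ) (M : ℝ) : Prop :=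
  ContDiffOn ℝ 1 b (Qbar T) ∧
    ∀ p ∈ Qbar T, |b p| ≤ M ∧
      |fderivWithin ℝ b (Qbar T) p (1, 0)| ≤ M ∧ |fderivWithin ℝ b (Qbar T) p (0, 1)| ≤ M

/-- The function `v` on `Q_T` has the boundary value (trace) `g` on one side of the rectangle, where
`d p` is the distance of `p ∈ Q_T` to that side and `g p` depends only on the projection of `p` to
it: the mean of `|v - g|` over the strip of width `h` along the side tends to `0` as `h → 0+`.
Changing `v` on a null set does not matter, `g` is determined almost everywhere on the side, and if
`v` is continuous up to the side, then `g` is the restriction of `v`. -/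
def HasBoundaryValue (T : ℝ) (d v g : ℝ × ℝ → ℝ) : Prop :=
  Tendsto (fun h : ℝ => (ENNReal.ofReal h)⁻¹ * ∫⁻ p in {p | p ∈ Q T ∧ d p < h}, ‖v p - g p‖ₑ)
    (𝓝[>] 0) (𝓝 0)

/-- `ψ ∈ H²(0,T)`, where `ψ` is the representative that is continuous on `[0,T]`, so that `ψ 0`
has a meaning. -/
def IsBoundaryDatum (T : ℝ) (ψ : ℝ → ℝ) : Prop :=
  MemH2 (Ioo 0 T) ψ ∧ ContinuousOn ψ (Icc 0 T)

/-- `v ∈ H²(Q_T)` solves `v_t + b v_xx = 0` in `Q_T`, `v(0,t) = ψ₀(t)` and `v(1,t) = ψ₁(t)` for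
`t ∈ (0,T)`, `v(x,0) = ψ₀(0) (1 - x) + ψ₁(0) x` for `x ∈ (0,1)`. -/
structure IsSolution (T : ℝ) (b : ℝ × ℝ → ℝ) (ψ₀ ψ₁ : ℝ → ℝ) (v : ℝ × ℝ → ℝ) : Prop where
  memH2 : MemH2 (Q T) v
  equation : ∃ vt vx vxx : ℝ × ℝ → ℝ,
    HasWeakDeriv (Q T) (0, 1) v vt ∧
    HasWeakDeriv (Q T) (1, 0) v vx ∧ HasWeakDeriv (Q T) (1, 0) vx vxx ∧
    ∀ᵐ p ∂(volume.restrict (Q T)), vt p + b p * vxx p = 0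
  left : HasBoundaryValue T (fun p => p.1) v (fun p => ψ₀ p.2)
  right : HasBoundaryValue T (fun p => 1 - p.1) v (fun p => ψ₁ p.2)
  initial : HasBoundaryValue T (fun p => p.2) v (fun p => ψ₀ 0 * (1 - p.1) + ψ₁ 0 * p.1)

end BackwardParabolic

/-! With the sign `v_t + b v_xx` and data at `t = 0` the problem is ill-posed, so uniqueness is a
backward uniqueness statement and is proved by a weighted energy (Carleman) estimate. Let `u` be the
difference of two solutions, `g = u_t`, `f = -u_xx`, `a = 1/b`. Then `f = a g`, and `u` has zero
trace at `x = 0`, `x = 1` and `t = 0`.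

The traces and weak derivatives are used only through two integral representations: `u(·,t) = K
f(·,t)`, where `K` is the Dirichlet Green operator of `-d²/dx²` on `(0,1)`, and `u(x,t) = ∫₀ᵗ g(x,s)
ds`. Both come from testing with products `θ(x) η(t)` and removing a cutoff at the sides where the
trace vanishes (`ae_eq_greenKernel_integral`, `ae_eq_primitiveKernel_integral`).

Put `D(t) = ∫ f u dx`, formally `∫ u_x² dx`. Since `K` is symmetric, `D' = 2 ∫ f g dx` with `D(0) =
0`. No time derivative of `f` is available, so this is obtained from difference quotients in
`ae_integral_mul_eq_of_symmetric`.

Choose `C` with `a_t ≤ C a`, and weights with `κ' = -C κ`, `P' = -2 κ P`. Then `(P D)' - (κ P ∫ a u²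
dx)' ≥ 2 P ∫ a (g - κ u)² dx ≥ 0`, so `κ ∫ a u² dx ≤ D` at almost every time (`weighted_energy_le`).
This holds for `κ = k e^{-Ct}` with every natural number `k`, while `D` does not depend on `k`.
Hence `∫ a u² dx = 0` and `u = 0`. -/

/-! ### Product test functions determine integrable functions on a rectangle -/

/-- The bump function at `x` with inner radius `r` and outer radius `r + 1 / (n + 1) * δ`. -/
noncomputable def bumpSeq (x r δ : ℝ) (hr : 0 < r) (hδ : 0 < δ) (n : ℕ) : ContDiffBump x where
  rIn := r
  rOut := r + δ / (n + 1)
  rIn_pos := hr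
  rIn_lt_rOut := by
    have : 0 < δ / ((n : ℝ) + 1) := by positivity
    linarith

lemma bumpSeq_tendsto (x r δ : ℝ) (hr : 0 < r) (hδ : 0 < δ) (y : ℝ) :
    Tendsto (fun n => bumpSeq x r δ hr hδ n y) atTop
      (𝓝 ((Metric.closedBall x r).indicator 1 y)) := by
  by_cases hy : y ∈ Metric.closedBall x r
  · rw [indicator_of_mem hy]
    refine tendsto_const_nhds.congr fun n => ?_
    exact ((bumpSeq x r δ hr hδ n).one_of_mem_closedBall hy).symm
  · rw [indicator_of_notMem hy]
    have h1 : Tendsto (fun n : ℕ => r + δ / ((n : ℝ) + 1)) atTop (𝓝 (r + 0)) :=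
      tendsto_const_nhds.add <| by
        have := (tendsto_one_div_add_atTop_nhds_zero_nat (𝕜 := ℝ)).const_mul δ
        rw [mul_zero] at this
        exact this.congr fun n => mul_one_div δ _
    rw [add_zero] at h1
    have h2 : r < dist y x := by simpa using hy
    refine tendsto_const_nhds.congr' ?_
    filter_upwards [h1.eventually (gt_mem_nhds h2)] with n hn
    exact ((bumpSeq x r δ hr hδ n).zero_of_le_dist hn.le).symm

lemma bumpSeq_tsupport (x r δ : ℝ) (hr : 0 < r) (hδ : 0 < δ) (n : ℕ) :
    tsupport (bumpSeq x r δ hr hδ n) ⊆ Metric.closedBall x (r + δ) := by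
  rw [ContDiffBump.tsupport_eq]
  refine Metric.closedBall_subset_closedBall ?_
  change r + δ / ((n : ℝ) + 1) ≤ r + δ
  have : δ / ((n : ℝ) + 1) ≤ δ := div_le_self hδ.le (by linarith [n.cast_nonneg (α := ℝ)])
  linarith

/-- By Lebesgue differentiation, `w` is almost everywhere the limit of its means over small balls.
Balls of `ℝ × ℝ` are squares in the sup metric, so their indicators are products of interval
indicators, which are bounded pointwise limits of products of bump functions; dominated convergence
makes every such mean vanish. -/
lemma ae_eq_zero_of_integral_prod_test {a b c d : ℝ} {w : ℝ × ℝ → ℝ}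
    (hw : Integrable w ((volume.restrict (Ioo a b)).prod (volume.restrict (Ioo c d))))
    (h : ∀ θ η : ℝ → ℝ, ContDiff ℝ ∞ θ → HasCompactSupport θ → tsupport θ ⊆ Ioo a b →
      ContDiff ℝ ∞ η → HasCompactSupport η → tsupport η ⊆ Ioo c d →
      ∫ p, w p * (θ p.1 * η p.2)
        ∂((volume.restrict (Ioo a b)).prod (volume.restrict (Ioo c d))) = 0) :
    w =ᵐ[(volume.restrict (Ioo a b)).prod (volume.restrict (Ioo c d))] 0 := by
  set S : Set (ℝ × ℝ) := Ioo a b ×ˢ Ioo c d with hS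
  have hSo : IsOpen S := isOpen_Ioo.prod isOpen_Ioo
  have hSm : MeasurableSet S := hSo.measurableSet
  have hμ : (volume.restrict (Ioo a b)).prod (volume.restrict (Ioo c d))
      = (volume : Measure (ℝ × ℝ)).restrict S := by
    rw [Measure.prod_restrict]; rfl
  rw [hμ] at hw h ⊢
  have hwi : Integrable (S.indicator w) := (integrable_indicator_iff hSm).2 hw
  have key : ∀ᵐ p, p ∈ S → S.indicator w p = 0 := by
    filter_upwards [(Besicovitch.vitaliFamily (volume : Measure (ℝ × ℝ))).ae_tendsto_average
      hwi.locallyIntegrable] with p hp hpS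
    have h1 := hp.comp (Besicovitch.tendsto_filterAt volume p)
    refine tendsto_nhds_unique (h1.congr' ?_) tendsto_const_nhds
    obtain ⟨ε, hε, hεS⟩ := Metric.isOpen_iff.1 hSo p hpS
    filter_upwards [Ioo_mem_nhdsGT (half_pos hε)] with r hr
    -- As `r < ε / 2`, the enlarged radius `r + ε / 4` stays below `ε`, so the supports of all the
    -- bump functions lie in the rectangle.
    have hδ : 0 < ε / 4 := by positivity
    have hsub : Metric.closedBall p.1 (r + ε / 4) ×ˢ Metric.closedBall p.2 (r + ε / 4) ⊆ S := by
      rw [closedBall_prod_same]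
      exact (Metric.closedBall_subset_ball (by linarith [hr.2])).trans hεS
    have hne : 0 ≤ r + ε / 4 := by linarith [hr.1]
    have hsub1 : Metric.closedBall p.1 (r + ε / 4) ⊆ Ioo a b := fun x hx =>
      (hsub (mk_mem_prod hx (Metric.mem_closedBall_self hne))).1
    have hsub2 : Metric.closedBall p.2 (r + ε / 4) ⊆ Ioo c d := fun x hx =>
      (hsub (mk_mem_prod (Metric.mem_closedBall_self hne) hx)).2
    have hcb : Metric.closedBall p r ⊆ S := by
      rw [← closedBall_prod_same]
      refine (Set.prod_mono ?_ ?_).trans hsub <;>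
        exact Metric.closedBall_subset_closedBall (by linarith)
    have hint : ∫ q in Metric.closedBall p r, S.indicator w q = 0 := by
      have e1 : ∫ q in Metric.closedBall p r, S.indicator w q
          = ∫ q in S, w q * ((Metric.closedBall p.1 r).indicator 1 q.1
              * (Metric.closedBall p.2 r).indicator 1 q.2) := by
        rw [← integral_indicator Metric.isClosed_closedBall.measurableSet,
          ← integral_indicator hSm]
        congr 1 with q
        by_cases hq : q ∈ Metric.closedBall p r
        · have hq' := hq
          rw [← closedBall_prod_same] at hq'
          rw [indicator_of_mem hq, indicator_of_mem (hcb hq), indicator_of_mem (hcb hq),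
            indicator_of_mem hq'.1, indicator_of_mem hq'.2]
          simp
        · rw [indicator_of_notMem hq]
          rw [← closedBall_prod_same] at hq
          have : ((Metric.closedBall p.1 r).indicator (1 : ℝ → ℝ) q.1
              * (Metric.closedBall p.2 r).indicator 1 q.2) = 0 := by
            by_cases h1 : q.1 ∈ Metric.closedBall p.1 r
            · have h2 : q.2 ∉ Metric.closedBall p.2 r := fun h2 => hq ⟨h1, h2⟩
              rw [indicator_of_notMem h2, mul_zero]
            · rw [indicator_of_notMem h1, zero_mul]
          by_cases hqS : q ∈ S
          · rw [indicator_of_mem hqS, this, mul_zero]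
          · rw [indicator_of_notMem hqS]
      rw [e1]
      have hlim : Tendsto (fun n : ℕ => ∫ q in S, w q * (bumpSeq p.1 r (ε / 4) hr.1 hδ n q.1
          * bumpSeq p.2 r (ε / 4) hr.1 hδ n q.2)) atTop
          (𝓝 (∫ q in S, w q * ((Metric.closedBall p.1 r).indicator 1 q.1
              * (Metric.closedBall p.2 r).indicator 1 q.2))) := by
        refine tendsto_integral_of_dominated_convergence (fun q => ‖w q‖) (fun n => ?_)
          hw.norm (fun n => ?_) ?_
        · refine hw.aestronglyMeasurable.mul (Continuous.aestronglyMeasurable ?_)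
          exact ((ContDiffBump.continuous _).comp continuous_fst).mul
            ((ContDiffBump.continuous _).comp continuous_snd)
        · refine Eventually.of_forall fun q => ?_
          rw [norm_mul]
          refine mul_le_of_le_one_right (norm_nonneg _) ?_
          rw [Real.norm_of_nonneg (mul_nonneg (ContDiffBump.nonneg _) (ContDiffBump.nonneg _))]
          exact mul_le_one₀ (ContDiffBump.le_one _) (ContDiffBump.nonneg _)
            (ContDiffBump.le_one _)
        · refine Eventually.of_forall fun q => ?_
          exact tendsto_const_nhds.mul ((bumpSeq_tendsto _ _ _ hr.1 hδ _).mul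
            (bumpSeq_tendsto _ _ _ hr.1 hδ _))
      refine tendsto_nhds_unique (hlim.congr fun n => ?_) tendsto_const_nhds
      exact h _ _ (ContDiffBump.contDiff _) (ContDiffBump.hasCompactSupport _)
        ((bumpSeq_tsupport _ _ _ hr.1 hδ n).trans hsub1)
        (ContDiffBump.contDiff _) (ContDiffBump.hasCompactSupport _)
        ((bumpSeq_tsupport _ _ _ hr.1 hδ n).trans hsub2)
    simp [Function.comp, setAverage_eq, hint]
  refine (ae_restrict_iff' hSm).2 ?_
  filter_upwards [key] with p hp hpS
  simpa [indicator_of_mem hpS] using hp hpS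

/-- If `u` and the kernel operator applied to `f` agree against product test functions, then they
agree almost everywhere. -/
lemma ae_eq_kernel_of_test {a b c d : ℝ} {k u f : ℝ × ℝ → ℝ} {M : ℝ}
    (hk : Measurable k) (hkM : ∀ x ∈ Ioo a b, ∀ y ∈ Ioo a b, ‖k (x, y)‖ ≤ M)
    (hu : Integrable u ((volume.restrict (Ioo a b)).prod (volume.restrict (Ioo c d))))
    (hf : Integrable f ((volume.restrict (Ioo a b)).prod (volume.restrict (Ioo c d))))
    (h : ∀ θ η : ℝ → ℝ, ContDiff ℝ ∞ θ → HasCompactSupport θ → tsupport θ ⊆ Ioo a b →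
      ContDiff ℝ ∞ η → HasCompactSupport η → tsupport η ⊆ Ioo c d →
      ∫ x in Ioo a b, (∫ t in Ioo c d, u (x, t) * η t) * θ x
        = ∫ y in Ioo a b, (∫ t in Ioo c d, f (y, t) * η t) * ∫ x in Ioo a b, k (x, y) * θ x) :
    ∀ᵐ p ∂((volume.restrict (Ioo a b)).prod (volume.restrict (Ioo c d))),
      u p = ∫ y in Ioo a b, k (p.1, y) * f (y, p.2) := by
  set μ := (volume : Measure ℝ).restrict (Ioo a b) with hμ
  set ν := (volume : Measure ℝ).restrict (Ioo c d) with hν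
  have : IsFiniteMeasure μ := by rw [hμ]; infer_instance
  have : IsFiniteMeasure ν := by rw [hν]; infer_instance
  have hmem : ∀ᵐ x ∂μ, x ∈ Ioo a b := ae_restrict_mem measurableSet_Ioo
  -- the function `(x, (y, t)) ↦ k (x, y) f (y, t)`
  have hF : Integrable (fun q : ℝ × (ℝ × ℝ) => k (q.1, q.2.1) * f q.2) (μ.prod (μ.prod ν)) := by
    have h1 : Integrable (fun q : ℝ × (ℝ × ℝ) => f q.2) (μ.prod (μ.prod ν)) := hf.comp_snd μ
    refine h1.bdd_mul (c := M) ?_ ?_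
    · exact (hk.comp (measurable_fst.prodMk (measurable_fst.comp measurable_snd))
        ).aestronglyMeasurable
    · have e1 : ∀ᵐ q ∂(μ.prod (μ.prod ν)), q.1 ∈ Ioo a b :=
        Measure.quasiMeasurePreserving_fst.ae hmem
      have e2 : ∀ᵐ q ∂(μ.prod (μ.prod ν)), q.2.1 ∈ Ioo a b :=
        (Measure.quasiMeasurePreserving_fst.comp Measure.quasiMeasurePreserving_snd).ae hmem
      filter_upwards [e1, e2] with q h1 h2 using hkM _ h1 _ h2
  have m1 : MeasurePreserving (fun q : (ℝ × ℝ) × ℝ => (q.1.1, (q.2, q.1.2)))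
      ((μ.prod ν).prod μ) (μ.prod (μ.prod ν)) := by
    have p1 := measurePreserving_prodAssoc μ ν μ
    have p2 : MeasurePreserving (Prod.map id Prod.swap) (μ.prod (ν.prod μ))
      (μ.prod (μ.prod ν)) := (MeasurePreserving.id μ).prod Measure.measurePreserving_swap
    exact p2.comp p1
  -- rearranged as a function of `((x, t), y)`
  have hG : Integrable (fun q : (ℝ × ℝ) × ℝ => k (q.1.1, q.2) * f (q.2, q.1.2))
      ((μ.prod ν).prod μ) := by
    exact m1.integrable_comp_of_integrable hF
  have hKf : Integrable (fun p : ℝ × ℝ => ∫ y, k (p.1, y) * f (y, p.2) ∂μ) (μ.prod ν) :=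
    hG.integral_prod_left
  have := ae_eq_zero_of_integral_prod_test (a := a) (b := b) (c := c) (d := d)
    (w := fun p => u p - ∫ y, k (p.1, y) * f (y, p.2) ∂μ) (hu.sub hKf) ?_
  · filter_upwards [this] with p hp
    simpa [sub_eq_zero] using hp
  intro θ η hθ hθc hθs hη hηc hηs
  obtain ⟨Cθ, hCθ⟩ := hθc.exists_bound_of_continuous hθ.continuous
  obtain ⟨Cη, hCη⟩ := hηc.exists_bound_of_continuous hη.continuous
  have hbd : ∀ p : ℝ × ℝ, ‖θ p.1 * η p.2‖ ≤ Cθ * Cη := fun p => by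
    rw [norm_mul]
    exact mul_le_mul (hCθ _) (hCη _) (norm_nonneg _) ((norm_nonneg _).trans (hCθ 0))
  have hcont : Continuous fun p : ℝ × ℝ => θ p.1 * η p.2 :=
    (hθ.continuous.comp continuous_fst).mul (hη.continuous.comp continuous_snd)
  have i1 : Integrable (fun p : ℝ × ℝ => u p * (θ p.1 * η p.2)) (μ.prod ν) :=
    hu.mul_bdd hcont.aestronglyMeasurable (Eventually.of_forall hbd)
  have i2 : Integrable (fun p : ℝ × ℝ => (∫ y, k (p.1, y) * f (y, p.2) ∂μ) * (θ p.1 * η p.2))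
      (μ.prod ν) := hKf.mul_bdd hcont.aestronglyMeasurable (Eventually.of_forall hbd)
  have s1 : ∫ p, u p * (θ p.1 * η p.2) ∂(μ.prod ν)
      = ∫ x, (∫ t, u (x, t) * η t ∂ν) * θ x ∂μ := by
    rw [integral_prod _ i1]
    congr 1 with x
    rw [← integral_mul_const]
    congr 1 with t
    ring
  have i3 : Integrable (fun q : ℝ × (ℝ × ℝ) => k (q.1, q.2.1) * f q.2 * (θ q.1 * η q.2.2))
      (μ.prod (μ.prod ν)) :=
    hF.mul_bdd (c := Cθ * Cη)
      (hcont.comp (continuous_fst.prodMk (continuous_snd.comp continuous_snd))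
        ).aestronglyMeasurable (Eventually.of_forall fun q => hbd (q.1, q.2.2))
  have s2 : ∫ p, (∫ y, k (p.1, y) * f (y, p.2) ∂μ) * (θ p.1 * η p.2) ∂(μ.prod ν)
      = ∫ y, (∫ t, f (y, t) * η t ∂ν) * (∫ x, k (x, y) * θ x ∂μ) ∂μ := by
    have t1 : ∫ p, (∫ y, k (p.1, y) * f (y, p.2) ∂μ) * (θ p.1 * η p.2) ∂(μ.prod ν)
        = ∫ q, k (q.1, q.2.1) * f q.2 * (θ q.1 * η q.2.2) ∂(μ.prod (μ.prod ν)) := by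
      have i4 : Integrable (fun q : (ℝ × ℝ) × ℝ => k (q.1.1, q.2) * f (q.2, q.1.2) *
          (θ q.1.1 * η q.1.2)) ((μ.prod ν).prod μ) := m1.integrable_comp_of_integrable i3
      rw [← m1.map_eq, integral_map m1.measurable.aemeasurable
        (by rw [m1.map_eq]; exact i3.aestronglyMeasurable), integral_prod _ i4]
      congr 1 with p
      rw [← integral_mul_const]
    rw [t1, integral_prod_symm _ i3, integral_prod _ i3.integral_prod_right]
    congr 1 with y
    rw [← integral_mul_const]
    congr 1 with t
    rw [← integral_const_mul]
    congr 1 with x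
    ring
  calc ∫ p, (u p - ∫ y, k (p.1, y) * f (y, p.2) ∂μ) * (θ p.1 * η p.2) ∂(μ.prod ν)
      = ∫ p, (u p * (θ p.1 * η p.2)
          - (∫ y, k (p.1, y) * f (y, p.2) ∂μ) * (θ p.1 * η p.2)) ∂(μ.prod ν) := by
        congr 1 with p; ring
    _ = 0 := by
        rw [integral_sub i1 i2, s1, s2, h θ η hθ hθc hθs hη hηc hηs, sub_self]

/-! ### Removing cutoffs at an endpoint where the trace vanishes -/

/-- A smooth step vanishing on `(-∞, 1/3]` and equal to `1` on `[2/3, ∞)`. -/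
noncomputable def smoothStep (s : ℝ) : ℝ := Real.smoothTransition (3 * s - 1)

namespace smoothStep

lemma contDiff : ContDiff ℝ ∞ smoothStep :=
  Real.smoothTransition.contDiff.comp ((contDiff_const.mul contDiff_id).sub contDiff_const)

lemma nonneg (s : ℝ) : 0 ≤ smoothStep s := Real.smoothTransition.nonneg _

lemma le_one (s : ℝ) : smoothStep s ≤ 1 := Real.smoothTransition.le_one _

lemma eq_zero {s : ℝ} (h : s ≤ 1 / 3) : smoothStep s = 0 :=
  Real.smoothTransition.zero_of_nonpos (by linarith)

lemma eq_one {s : ℝ} (h : 2 / 3 ≤ s) : smoothStep s = 1 :=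
  Real.smoothTransition.one_of_one_le (by linarith)

lemma deriv_eq_zero {s : ℝ} (h : 2 / 3 < s) : deriv smoothStep s = 0 := by
  have : smoothStep =ᶠ[𝓝 s] fun _ => 1 := by
    filter_upwards [lt_mem_nhds h] with x hx using eq_one hx.le
  rw [this.deriv_eq, deriv_const]

lemma deriv_deriv_eq_zero {s : ℝ} (h : 2 / 3 < s) : deriv (deriv smoothStep) s = 0 := by
  have : deriv smoothStep =ᶠ[𝓝 s] fun _ => 0 := by
    filter_upwards [lt_mem_nhds h] with x hx using deriv_eq_zero hx
  rw [this.deriv_eq, deriv_const]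

lemma contDiff_deriv : ContDiff ℝ ∞ (deriv smoothStep) :=
  (contDiff_infty_iff_deriv.1 contDiff).2

lemma contDiff_deriv_deriv : ContDiff ℝ ∞ (deriv (deriv smoothStep)) :=
  (contDiff_infty_iff_deriv.1 contDiff_deriv).2

lemma exists_bound : ∃ C : ℝ, 0 ≤ C ∧ (∀ s ∈ Icc (0 : ℝ) 1, |deriv smoothStep s| ≤ C) ∧
    ∀ s ∈ Icc (0 : ℝ) 1, |deriv (deriv smoothStep) s| ≤ C := by
  obtain ⟨C₁, h₁⟩ := isCompact_Icc.exists_bound_of_continuousOn (s := Icc (0 : ℝ) 1)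
    contDiff_deriv.continuous.continuousOn
  obtain ⟨C₂, h₂⟩ := isCompact_Icc.exists_bound_of_continuousOn (s := Icc (0 : ℝ) 1)
    contDiff_deriv_deriv.continuous.continuousOn
  refine ⟨max 0 (max C₁ C₂), le_max_left _ _, fun s hs => ?_, fun s hs => ?_⟩
  · exact (h₁ s hs).trans ((le_max_left _ _).trans (le_max_right _ _))
  · exact (h₂ s hs).trans ((le_max_right _ _).trans (le_max_right _ _))

end smoothStep

/-- The mean of `|W|` over `(0, T) ∩ (-∞, h)` tends to `0` as `h → 0+`. -/
def ZeroMeanTrace (T : ℝ) (W : ℝ → ℝ) : Prop :=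
  Tendsto (fun h : ℝ => h⁻¹ * ∫ x in Ioo 0 T ∩ Iio h, |W x|) (𝓝[>] 0) (𝓝 0)

/-- A factor of size `C / h` living on the strip `x < h` turns the integral into at most `C` times
the mean of `|W|` over that strip. Derivatives of the cutoff `smoothStep (x / h)` are of this kind.
-/
lemma ZeroMeanTrace.tendsto_integral_mul {T C : ℝ} {W : ℝ → ℝ} {ρ : ℝ → ℝ → ℝ}
    (hW : IntegrableOn W (Ioo 0 T)) (htr : ZeroMeanTrace T W)
    (h₁ : ∀ h > 0, ∀ x ∈ Ioo 0 T, x < h → |ρ h x| ≤ C * h⁻¹)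
    (h₂ : ∀ h > 0, ∀ x ∈ Ioo 0 T, h ≤ x → ρ h x = 0) :
    Tendsto (fun h => ∫ x in Ioo 0 T, W x * ρ h x) (𝓝[>] 0) (𝓝 0) := by
  have h0 := htr.const_mul C
  rw [mul_zero] at h0
  refine squeeze_zero_norm' ?_ h0
  filter_upwards [self_mem_nhdsWithin] with h hh
  have e : C * (h⁻¹ * ∫ x in Ioo 0 T ∩ Iio h, |W x|)
      = ∫ x in Ioo 0 T, (Iio h).indicator (fun x => C * h⁻¹ * |W x|) x := by
    rw [setIntegral_indicator measurableSet_Iio, integral_const_mul, mul_assoc]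
  rw [e]
  refine norm_integral_le_of_norm_le ?_ ?_
  · exact (hW.abs.const_mul _).indicator measurableSet_Iio
  · filter_upwards [ae_restrict_mem measurableSet_Ioo] with x hx
    by_cases hxh : x < h
    · rw [indicator_of_mem (show x ∈ Iio h from hxh), Real.norm_eq_abs, abs_mul, mul_comm]
      exact mul_le_mul_of_nonneg_right (h₁ h hh x hx hxh) (abs_nonneg _)
    · rw [indicator_of_notMem (show x ∉ Iio h from hxh), h₂ h hh x hx (not_lt.1 hxh)]
      simp

lemma tendsto_integral_mul_smoothStep {T : ℝ} {F φ : ℝ → ℝ} (hF : IntegrableOn F (Ioo 0 T))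
    (hφ : Continuous φ) :
    Tendsto (fun h => ∫ x in Ioo 0 T, F x * (smoothStep (h⁻¹ * x) * φ x)) (𝓝[>] 0)
      (𝓝 (∫ x in Ioo 0 T, F x * φ x)) := by
  obtain ⟨M, hM⟩ := isCompact_Icc.exists_bound_of_continuousOn (s := Icc 0 T) hφ.continuousOn
  refine tendsto_integral_filter_of_dominated_convergence (fun x => ‖F x‖ * M) ?_ ?_
    (hF.norm.mul_const M) ?_
  · refine Eventually.of_forall fun h => hF.aestronglyMeasurable.mul ?_
    exact ((smoothStep.contDiff.continuous.comp (continuous_const.mul continuous_id)).mul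
      hφ).aestronglyMeasurable
  · refine Eventually.of_forall fun h => ?_
    filter_upwards [ae_restrict_mem measurableSet_Ioo] with x hx
    rw [norm_mul, norm_mul, Real.norm_of_nonneg (smoothStep.nonneg _)]
    refine mul_le_mul_of_nonneg_left ?_ (norm_nonneg _)
    exact (mul_le_of_le_one_left (norm_nonneg _) (smoothStep.le_one _)).trans
      (hM x (Ioo_subset_Icc_self hx))
  · filter_upwards [ae_restrict_mem measurableSet_Ioo] with x hx
    refine tendsto_const_nhds.congr' ?_
    filter_upwards [Ioo_mem_nhdsGT hx.1] with h hh
    rw [smoothStep.eq_one, one_mul]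
    have : 1 ≤ h⁻¹ * x := by
      rw [inv_mul_eq_div, one_le_div hh.1]; exact hh.2.le
    linarith

lemma contDiff_smoothStep_mul {φ : ℝ → ℝ} (hφ : ContDiff ℝ ∞ φ) (h : ℝ) :
    ContDiff ℝ ∞ (fun x => smoothStep (h⁻¹ * x) * φ x) :=
  (smoothStep.contDiff.comp (contDiff_const.mul contDiff_id)).mul hφ

lemma deriv_smoothStep_mul {φ : ℝ → ℝ} (hφ : ContDiff ℝ ∞ φ) (h : ℝ) :
    deriv (fun x => smoothStep (h⁻¹ * x) * φ x) = fun x =>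
      h⁻¹ * deriv smoothStep (h⁻¹ * x) * φ x + smoothStep (h⁻¹ * x) * deriv φ x := by
  ext x
  rw [deriv_fun_mul, deriv_comp_mul_left]
  · rfl
  · exact ((smoothStep.contDiff.differentiable (by simp)).comp
      ((differentiable_const _).mul differentiable_id)) x
  · exact hφ.differentiable (by simp) x

lemma deriv_deriv_smoothStep_mul {φ : ℝ → ℝ} (hφ : ContDiff ℝ ∞ φ) (h : ℝ) :
    deriv (deriv (fun x => smoothStep (h⁻¹ * x) * φ x)) = fun x =>
      (h⁻¹ ^ 2 * deriv (deriv smoothStep) (h⁻¹ * x) * φ x +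
        2 * h⁻¹ * deriv smoothStep (h⁻¹ * x) * deriv φ x)
        + smoothStep (h⁻¹ * x) * deriv (deriv φ) x := by
  have hφ' := (contDiff_infty_iff_deriv.1 hφ).2
  rw [deriv_smoothStep_mul hφ]
  ext x
  have d0 : DifferentiableAt ℝ (fun x => smoothStep (h⁻¹ * x)) x :=
    ((smoothStep.contDiff.differentiable (by simp)).comp
      ((differentiable_const _).mul differentiable_id)) x
  have d1 : DifferentiableAt ℝ (fun x => deriv smoothStep (h⁻¹ * x)) x :=
    ((smoothStep.contDiff_deriv.differentiable (by simp)).comp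
      ((differentiable_const _).mul differentiable_id)) x
  have d2 := hφ.differentiable (by simp) x
  have d3 := hφ'.differentiable (by simp) x
  rw [deriv_fun_add ((d1.const_mul _).fun_mul d2) (d0.fun_mul d3), deriv_fun_mul (d1.const_mul _) d2,
    deriv_fun_mul d0 d3, deriv_const_mul _ d1, deriv_comp_mul_left, deriv_comp_mul_left]
  simp only [smul_eq_mul]
  ring

/-- Removing the cutoff near `0` in a first order weak identity, for `W` with zero trace. -/
lemma integral_mul_deriv_of_cutoff {T : ℝ} {W G φ : ℝ → ℝ} (hW : IntegrableOn W (Ioo 0 T))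
    (hG : IntegrableOn G (Ioo 0 T)) (htr : ZeroMeanTrace T W) (hφ : ContDiff ℝ ∞ φ)
    (H : ∀ h > 0, ∫ x in Ioo 0 T, W x * deriv (fun x => smoothStep (h⁻¹ * x) * φ x) x
      = - ∫ x in Ioo 0 T, G x * (smoothStep (h⁻¹ * x) * φ x)) :
    ∫ x in Ioo 0 T, W x * deriv φ x = - ∫ x in Ioo 0 T, G x * φ x := by
  have hφ' := (contDiff_infty_iff_deriv.1 hφ).2
  obtain ⟨C, hC0, hC1, -⟩ := smoothStep.exists_bound
  obtain ⟨M, hM⟩ := isCompact_Icc.exists_bound_of_continuousOn (s := Icc 0 T)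
    hφ.continuous.continuousOn
  have t1 := tendsto_integral_mul_smoothStep hW hφ'.continuous
  have t2 := (tendsto_integral_mul_smoothStep hG hφ.continuous).neg
  have t3 : Tendsto (fun h => ∫ x in Ioo 0 T, W x * (h⁻¹ * deriv smoothStep (h⁻¹ * x) * φ x))
      (𝓝[>] 0) (𝓝 0) := by
    refine htr.tendsto_integral_mul (C := C * M) hW (fun h hh x hx hxh => ?_)
      (fun h hh x hx hxh => ?_)
    · have hi : 0 < h⁻¹ := inv_pos.2 hh
      have hs : h⁻¹ * x ∈ Icc (0 : ℝ) 1 :=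
        ⟨(mul_pos hi hx.1).le, by rw [inv_mul_eq_div, div_le_one hh]; exact hxh.le⟩
      rw [abs_mul, abs_mul, abs_of_pos hi]
      have := mul_le_mul (hC1 _ hs) (hM x (Ioo_subset_Icc_self hx)) (norm_nonneg _) hC0
      rw [Real.norm_eq_abs] at this
      nlinarith
    · rw [smoothStep.deriv_eq_zero]
      · simp
      · have : 1 ≤ h⁻¹ * x := by rw [inv_mul_eq_div, one_le_div hh]; exact hxh
        linarith
  have t4 := t3.add t1
  rw [zero_add] at t4
  refine tendsto_nhds_unique (t4.congr' ?_) t2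
  filter_upwards [self_mem_nhdsWithin] with h hh
  rw [← H h hh, deriv_smoothStep_mul hφ, ← integral_add]
  · congr 1 with x; ring
  · refine hW.mul_continuousOn_of_subset (K := Icc 0 T) ?_ measurableSet_Ioo isCompact_Icc
      Ioo_subset_Icc_self
    exact ((continuous_const.mul (smoothStep.contDiff_deriv.continuous.comp
      (continuous_const.mul continuous_id))).mul hφ.continuous).continuousOn
  · refine hW.mul_continuousOn_of_subset (K := Icc 0 T) ?_ measurableSet_Ioo isCompact_Icc
      Ioo_subset_Icc_self
    exact ((smoothStep.contDiff.continuous.comp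
      (continuous_const.mul continuous_id)).mul hφ'.continuous).continuousOn

/-- Removing the cutoff near `0` in a second order weak identity, for `W` with zero trace. -/
lemma integral_mul_deriv_deriv_of_cutoff {T : ℝ} {W R φ : ℝ → ℝ} (hW : IntegrableOn W (Ioo 0 T))
    (hR : IntegrableOn R (Ioo 0 T)) (htr : ZeroMeanTrace T W) (hφ : ContDiff ℝ ∞ φ) (hφ0 : φ 0 = 0)
    (H : ∀ h > 0, ∫ x in Ioo 0 T, W x * deriv (deriv (fun x => smoothStep (h⁻¹ * x) * φ x)) x
      = ∫ x in Ioo 0 T, R x * (smoothStep (h⁻¹ * x) * φ x)) :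
    ∫ x in Ioo 0 T, W x * deriv (deriv φ) x = ∫ x in Ioo 0 T, R x * φ x := by
  have hφ' := (contDiff_infty_iff_deriv.1 hφ).2
  have hφ'' := (contDiff_infty_iff_deriv.1 hφ').2
  obtain ⟨C, hC0, hC1, hC2⟩ := smoothStep.exists_bound
  obtain ⟨M, hM⟩ := isCompact_Icc.exists_bound_of_continuousOn (s := Icc 0 T)
    hφ'.continuous.continuousOn
  -- Two derivatives on the cutoff cost `h⁻²`, while the trace condition absorbs only `h⁻¹`. Since
  -- `φ 0 = 0`, the factor `|φ x| ≤ M x`, with `x < h` where the derivative of the cutoff lives,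
  -- supplies the missing power.
  have hφM : ∀ x ∈ Ioo 0 T, |φ x| ≤ M * x := fun x hx => by
    have := (convex_Icc 0 T).norm_image_sub_le_of_norm_deriv_le (f := φ) (C := M)
      (fun y _ => hφ.differentiable (by simp) y) hM
      (left_mem_Icc.2 (hx.1.trans hx.2).le) (Ioo_subset_Icc_self hx)
    simpa [hφ0, abs_of_pos hx.1] using this
  have t1 := tendsto_integral_mul_smoothStep hW hφ''.continuous
  have t2 := tendsto_integral_mul_smoothStep hR hφ.continuous
  have t3 : Tendsto (fun h => ∫ x in Ioo 0 T, W x *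
      (h⁻¹ ^ 2 * deriv (deriv smoothStep) (h⁻¹ * x) * φ x +
        2 * h⁻¹ * deriv smoothStep (h⁻¹ * x) * deriv φ x)) (𝓝[>] 0) (𝓝 0) := by
    -- One `C * M` comes from the second derivative of the cutoff, two more from the doubled cross
    -- term.
    refine htr.tendsto_integral_mul (C := 3 * (C * M)) hW (fun h hh x hx hxh => ?_)
      (fun h hh x hx hxh => ?_)
    · have hi : 0 < h⁻¹ := inv_pos.2 hh
      have hx1 : h⁻¹ * x ≤ 1 := by rw [inv_mul_eq_div, div_le_one hh]; exact hxh.le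
      have hs : h⁻¹ * x ∈ Icc (0 : ℝ) 1 := ⟨(mul_pos hi hx.1).le, hx1⟩
      have hM' := hM x (Ioo_subset_Icc_self hx)
      rw [Real.norm_eq_abs] at hM'
      have hM0 : 0 ≤ M := (abs_nonneg _).trans hM'
      have b1 : |h⁻¹ ^ 2 * deriv (deriv smoothStep) (h⁻¹ * x) * φ x| ≤ C * M * h⁻¹ := by
        rw [abs_mul, abs_mul, abs_of_pos (pow_pos hi 2)]
        calc h⁻¹ ^ 2 * |deriv (deriv smoothStep) (h⁻¹ * x)| * |φ x|
            ≤ h⁻¹ ^ 2 * C * (M * x) := by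
              gcongr
              · exact hC2 _ hs
              · exact hφM x hx
          _ = C * M * h⁻¹ * (h⁻¹ * x) := by ring
          _ ≤ C * M * h⁻¹ := mul_le_of_le_one_right (by positivity) hx1
      have b2 : |2 * h⁻¹ * deriv smoothStep (h⁻¹ * x) * deriv φ x| ≤ 2 * (C * M * h⁻¹) := by
        rw [abs_mul, abs_mul, abs_of_pos (mul_pos two_pos hi)]
        calc 2 * h⁻¹ * |deriv smoothStep (h⁻¹ * x)| * |deriv φ x| ≤ 2 * h⁻¹ * C * M := by
              gcongr
              exact hC1 _ hs
          _ = 2 * (C * M * h⁻¹) := by ring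
      exact (abs_add_le _ _).trans (by linarith)
    · have : 1 ≤ h⁻¹ * x := by rw [inv_mul_eq_div, one_le_div hh]; exact hxh
      rw [smoothStep.deriv_eq_zero (by linarith), smoothStep.deriv_deriv_eq_zero (by linarith)]
      simp
  have t4 := t3.add t1
  rw [zero_add] at t4
  refine tendsto_nhds_unique (t4.congr' ?_) t2
  filter_upwards [self_mem_nhdsWithin] with h hh
  rw [← H h hh, deriv_deriv_smoothStep_mul hφ, ← integral_add]
  · congr 1 with x; ring
  · refine hW.mul_continuousOn_of_subset (K := Icc 0 T) ?_ measurableSet_Ioo isCompact_Icc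
      Ioo_subset_Icc_self
    have c1 := smoothStep.contDiff_deriv.continuous.comp
      (continuous_const.mul continuous_id : Continuous fun x : ℝ => h⁻¹ * x)
    have c2 := smoothStep.contDiff_deriv_deriv.continuous.comp
      (continuous_const.mul continuous_id : Continuous fun x : ℝ => h⁻¹ * x)
    exact (((continuous_const.mul c2).mul hφ.continuous).add
      ((continuous_const.mul c1).mul hφ'.continuous)).continuousOn
  · refine hW.mul_continuousOn_of_subset (K := Icc 0 T) ?_ measurableSet_Ioo isCompact_Icc
      Ioo_subset_Icc_self
    exact ((smoothStep.contDiff.continuous.comp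
      (continuous_const.mul continuous_id)).mul hφ''.continuous).continuousOn

lemma tsupport_smoothStep_mul_subset {φ : ℝ → ℝ} {h : ℝ} (hh : 0 < h) :
    tsupport (fun x => smoothStep (h⁻¹ * x) * φ x) ⊆ Ioi 0 ∩ tsupport φ := by
  refine subset_inter ?_ (tsupport_mul_subset_right (f := fun x => smoothStep (h⁻¹ * x)))
  have h1 : tsupport (fun x => smoothStep (h⁻¹ * x) * φ x) ⊆ Ici (h / 3) := by
    refine closure_minimal (fun x hx => ?_) isClosed_Ici
    by_contra hlt
    refine hx ?_
    have h2 : x < h / 3 := not_le.1 hlt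
    have : h⁻¹ * x ≤ 1 / 3 := by
      rw [inv_mul_eq_div, div_le_iff₀ hh]; linarith
    simp [smoothStep.eq_zero this]
  exact h1.trans fun x hx => lt_of_lt_of_le (show (0 : ℝ) < h / 3 by positivity) hx

lemma hasCompactSupport_of_tsupport_subset_Ioo {φ : ℝ → ℝ} {a b : ℝ} (h : tsupport φ ⊆ Ioo a b) :
    HasCompactSupport φ :=
  isCompact_Icc.of_isClosed_subset (isClosed_tsupport φ) (h.trans Ioo_subset_Icc_self)

lemma integral_mul_deriv_of_zeroMeanTrace {T : ℝ} {W G φ : ℝ → ℝ}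
    (hW : IntegrableOn W (Ioo 0 T)) (hG : IntegrableOn G (Ioo 0 T)) (htr : ZeroMeanTrace T W)
    (H : ∀ η : ℝ → ℝ, ContDiff ℝ ∞ η → HasCompactSupport η → tsupport η ⊆ Ioo 0 T →
      ∫ x in Ioo 0 T, W x * deriv η x = - ∫ x in Ioo 0 T, G x * η x)
    (hφ : ContDiff ℝ ∞ φ) (hs : tsupport φ ⊆ Iio T) :
    ∫ x in Ioo 0 T, W x * deriv φ x = - ∫ x in Ioo 0 T, G x * φ x := by
  refine integral_mul_deriv_of_cutoff hW hG htr hφ fun h hh => ?_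
  have hsub : tsupport (fun x => smoothStep (h⁻¹ * x) * φ x) ⊆ Ioo 0 T :=
    fun x hx => ⟨(tsupport_smoothStep_mul_subset hh hx).1,
      hs (tsupport_smoothStep_mul_subset hh hx).2⟩
  exact H _ (contDiff_smoothStep_mul hφ h) (hasCompactSupport_of_tsupport_subset_Ioo hsub) hsub

lemma setIntegral_Ioo_reflect (T : ℝ) (F : ℝ → ℝ) :
    ∫ x in Ioo 0 T, F (T - x) = ∫ x in Ioo 0 T, F x := by
  have h := (Measure.measurePreserving_sub_left volume T).setIntegral_preimage_emb
    (MeasurableEquiv.subLeft T).measurableEmbedding F (Ioo 0 T)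
  simpa using h

lemma IntegrableOn.reflect {T : ℝ} {F : ℝ → ℝ} (hF : IntegrableOn F (Ioo 0 T)) :
    IntegrableOn (fun x => F (T - x)) (Ioo 0 T) := by
  have h := ((Measure.measurePreserving_sub_left volume T).integrableOn_comp_preimage
    (MeasurableEquiv.subLeft T).measurableEmbedding (s := Ioo 0 T) (f := F)).2 hF
  simpa [Function.comp_def] using h

/-- The two cutoffs are removed one after the other: the one at `0` directly, for functions already
vanishing near `T`, then the one at `T` by applying the same argument after the reflection `x ↦ T -
x`. -/
lemma integral_mul_deriv_deriv_of_zeroMeanTrace {T : ℝ} {W R φ : ℝ → ℝ}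
    (hW : IntegrableOn W (Ioo 0 T)) (hR : IntegrableOn R (Ioo 0 T)) (htr : ZeroMeanTrace T W)
    (htr' : ZeroMeanTrace T (fun x => W (T - x)))
    (H : ∀ η : ℝ → ℝ, ContDiff ℝ ∞ η → HasCompactSupport η → tsupport η ⊆ Ioo 0 T →
      ∫ x in Ioo 0 T, W x * deriv (deriv η) x = ∫ x in Ioo 0 T, R x * η x)
    (hφ : ContDiff ℝ ∞ φ) (hφ0 : φ 0 = 0) (hφT : φ T = 0) :
    ∫ x in Ioo 0 T, W x * deriv (deriv φ) x = ∫ x in Ioo 0 T, R x * φ x := by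
  have step : ∀ η : ℝ → ℝ, ContDiff ℝ ∞ η → η 0 = 0 → tsupport η ⊆ Iio T →
      ∫ x in Ioo 0 T, W x * deriv (deriv η) x = ∫ x in Ioo 0 T, R x * η x := by
    intro η hη hη0 hs
    refine integral_mul_deriv_deriv_of_cutoff hW hR htr hη hη0 fun h hh => ?_
    have hsub : tsupport (fun x => smoothStep (h⁻¹ * x) * η x) ⊆ Ioo 0 T :=
      fun x hx => ⟨(tsupport_smoothStep_mul_subset hh hx).1,
        hs (tsupport_smoothStep_mul_subset hh hx).2⟩
    exact H _ (contDiff_smoothStep_mul hη h) (hasCompactSupport_of_tsupport_subset_Ioo hsub) hsub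
  have dd : ∀ ψ : ℝ → ℝ, deriv (deriv fun x => ψ (T - x)) = fun x => deriv (deriv ψ) (T - x) := by
    intro ψ
    have e1 : (deriv fun x => ψ (T - x)) = fun x => - deriv ψ (T - x) := by
      ext x; exact deriv_comp_const_sub ψ T x
    rw [e1]
    ext x
    rw [deriv.fun_neg, deriv_comp_const_sub (deriv ψ) T x, neg_neg]
  have key := integral_mul_deriv_deriv_of_cutoff (T := T) (W := fun x => W (T - x))
    (R := fun x => R (T - x)) (φ := fun x => φ (T - x)) (IntegrableOn.reflect hW)
    (IntegrableOn.reflect hR) htr' (hφ.comp (contDiff_const.sub contDiff_id)) (by simpa using hφT)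
    ?_
  · rw [dd] at key
    rwa [setIntegral_Ioo_reflect T (fun x => W x * deriv (deriv φ) x),
      setIntegral_Ioo_reflect T (fun x => R x * φ x)] at key
  intro h hh
  -- This is `φ` cut off near `T` only. It still vanishes at `0`, so it is admissible in `step`.
  set ψ : ℝ → ℝ := fun y => smoothStep (h⁻¹ * (T - y)) * φ y with hψ
  have e : (fun x => smoothStep (h⁻¹ * x) * φ (T - x)) = fun x => ψ (T - x) := by
    ext x; simp [hψ]
  have e' : ∀ x, smoothStep (h⁻¹ * x) * φ (T - x) = ψ (T - x) := fun x => congrFun e x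
  have hψs : ContDiff ℝ ∞ ψ := (smoothStep.contDiff.comp
    (contDiff_const.mul (contDiff_const.sub contDiff_id))).mul hφ
  have hsupp : tsupport ψ ⊆ Iio T := by
    have h1 : tsupport ψ ⊆ Iic (T - h / 3) := by
      refine closure_minimal (fun x hx => ?_) isClosed_Iic
      by_contra hlt
      refine hx ?_
      have h2 : T - h / 3 < x := not_le.1 hlt
      have : h⁻¹ * (T - x) ≤ 1 / 3 := by
        rw [inv_mul_eq_div, div_le_iff₀ hh]; linarith
      simp [hψ, smoothStep.eq_zero this]
    exact h1.trans fun x hx => lt_of_le_of_lt hx (by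
      have : (0 : ℝ) < h := hh
      linarith : T - h / 3 < T)
  simp only [e', dd]
  rw [setIntegral_Ioo_reflect T (fun x => W x * deriv (deriv ψ) x),
    setIntegral_Ioo_reflect T (fun x => R x * ψ x)]
  exact step ψ hψs (by simp [hψ, hφ0]) hsupp

/-! ### One-dimensional representations by the Green kernel and by the primitive -/

lemma hasDerivAt_integral_of_contDiff {θ : ℝ → ℝ} (hθ : ContDiff ℝ ∞ θ) (x : ℝ) :
    HasDerivAt (fun x => ∫ y in (0 : ℝ)..x, θ y) (θ x) x :=
  hθ.continuous.integral_hasStrictDerivAt 0 x |>.hasDerivAt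

lemma contDiff_integral_of_contDiff {θ : ℝ → ℝ} (hθ : ContDiff ℝ ∞ θ) :
    ContDiff ℝ ∞ (fun x => ∫ y in (0 : ℝ)..x, θ y) := by
  refine contDiff_infty_iff_deriv.2 ⟨fun x => (hasDerivAt_integral_of_contDiff hθ x).differentiableAt,
    ?_⟩
  rwa [funext fun x => (hasDerivAt_integral_of_contDiff hθ x).deriv]

/-- The Green kernel of `-d²/dx²` on `(0, 1)` with Dirichlet conditions. -/
def greenKernel (p : ℝ × ℝ) : ℝ := min p.1 p.2 - p.1 * p.2

lemma continuous_greenKernel : Continuous greenKernel := by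
  unfold greenKernel
  fun_prop

lemma greenKernel_swap (x y : ℝ) : greenKernel (x, y) = greenKernel (y, x) := by
  simp [greenKernel, min_comm, mul_comm]

lemma norm_greenKernel_le {x y : ℝ} (hx : x ∈ Ioo (0 : ℝ) 1) (hy : y ∈ Ioo (0 : ℝ) 1) :
    ‖greenKernel (x, y)‖ ≤ 1 := by
  have h1 : 0 ≤ min x y := le_min hx.1.le hy.1.le
  have h2 : min x y ≤ 1 := (min_le_left _ _).trans hx.2.le
  have h3 : 0 ≤ x * y := mul_nonneg hx.1.le hy.1.le
  have h4 : x * y ≤ 1 := mul_le_one₀ hx.2.le hy.1.le hy.2.le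
  rw [Real.norm_eq_abs, greenKernel, abs_le]
  constructor <;> simp only <;> linarith

/-- The kernel is affine in `x` on either side of `y`, so each half has an explicit primitive. The
boundary terms in `deriv Φ y` cancel, and those in `Φ y` add up to `-Φ y`. -/
lemma integral_greenKernel_mul_deriv_deriv {Φ : ℝ → ℝ} (hΦ : ContDiff ℝ ∞ Φ) (h0 : Φ 0 = 0)
    (h1 : Φ 1 = 0) {y : ℝ} (hy : y ∈ Ioo (0 : ℝ) 1) :
    ∫ x in Ioo (0 : ℝ) 1, greenKernel (x, y) * deriv (deriv Φ) x = - Φ y := by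
  have hΦ' := (contDiff_infty_iff_deriv.1 hΦ).2
  have hΦ'' := (contDiff_infty_iff_deriv.1 hΦ').2
  have d1 : ∀ x, HasDerivAt Φ (deriv Φ x) x := fun x =>
    (hΦ.differentiable (by simp) x).hasDerivAt
  have d2 : ∀ x, HasDerivAt (deriv Φ) (deriv (deriv Φ) x) x := fun x =>
    (hΦ'.differentiable (by simp) x).hasDerivAt
  have hc : Continuous fun x => greenKernel (x, y) * deriv (deriv Φ) x :=
    (continuous_greenKernel.comp (continuous_id.prodMk continuous_const)).mul hΦ''.continuous
  rw [← integral_Ioc_eq_integral_Ioo, ← intervalIntegral.integral_of_le zero_le_one,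
    ← intervalIntegral.integral_add_adjacent_intervals (b := y) (hc.intervalIntegrable _ _)
      (hc.intervalIntegrable _ _)]
  have e1 : ∫ x in (0 : ℝ)..y, greenKernel (x, y) * deriv (deriv Φ) x
      = (1 - y) * (y * deriv Φ y - Φ y) := by
    have := intervalIntegral.integral_eq_sub_of_hasDerivAt (a := 0) (b := y)
      (f := fun x => (1 - y) * (x * deriv Φ x - Φ x))
      (f' := fun x => (1 - y) * x * deriv (deriv Φ) x)
      (fun x _ => ((((hasDerivAt_id' x).mul (d2 x)).sub (d1 x)).const_mul (1 - y)).congr_deriv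
        (by ring))
      ((((continuous_const.mul continuous_id).mul hΦ''.continuous)).intervalIntegrable _ _)
    simp only [h0, zero_mul, sub_zero, mul_zero] at this
    rw [← this]
    refine intervalIntegral.integral_congr fun x hx => ?_
    rw [uIcc_of_le hy.1.le] at hx
    simp only [greenKernel, min_eq_left hx.2]
    ring
  have e2 : ∫ x in y..1, greenKernel (x, y) * deriv (deriv Φ) x
      = - (y * ((1 - y) * deriv Φ y + Φ y)) := by
    have := intervalIntegral.integral_eq_sub_of_hasDerivAt (a := y) (b := 1)
      (f := fun x => y * ((1 - x) * deriv Φ x + Φ x))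
      (f' := fun x => y * (1 - x) * deriv (deriv Φ) x)
      (fun x _ => (((((hasDerivAt_id' x).const_sub 1).mul (d2 x)).add (d1 x)).const_mul
        y).congr_deriv (by ring))
      (((continuous_const.mul (continuous_const.sub continuous_id)).mul
        hΦ''.continuous).intervalIntegrable _ _)
    simp only [h1, zero_mul, sub_self, add_zero, mul_zero, zero_sub] at this
    rw [← this]
    refine intervalIntegral.integral_congr fun x hx => ?_
    rw [uIcc_of_le hy.2.le] at hx
    simp only [greenKernel, min_eq_right hx.1]
    ring
  rw [e1, e2]
  ring

/-- Duality: the weak equation is tested with the solution `Φ` of `Φ'' = θ`, `Φ 0 = Φ 1 = 0`. It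
need not have compact support in `(0,1)`, which is why the zero traces of `W` are needed. -/
lemma integral_mul_eq_greenKernel {W R θ : ℝ → ℝ}
    (hW : IntegrableOn W (Ioo 0 1)) (hR : IntegrableOn R (Ioo 0 1)) (htr : ZeroMeanTrace 1 W)
    (htr' : ZeroMeanTrace 1 (fun x => W (1 - x)))
    (H : ∀ η : ℝ → ℝ, ContDiff ℝ ∞ η → HasCompactSupport η → tsupport η ⊆ Ioo 0 1 →
      ∫ x in Ioo 0 1, W x * deriv (deriv η) x = - ∫ x in Ioo 0 1, R x * η x)
    (hθ : ContDiff ℝ ∞ θ) :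
    ∫ x in Ioo 0 1, W x * θ x = ∫ y in Ioo 0 1, R y * ∫ x in Ioo 0 1, greenKernel (x, y) * θ x := by
  set A : ℝ → ℝ := fun x => ∫ y in (0 : ℝ)..x, θ y with hA
  have hAs : ContDiff ℝ ∞ A := contDiff_integral_of_contDiff hθ
  set B : ℝ → ℝ := fun x => ∫ y in (0 : ℝ)..x, A y with hB
  have hBs : ContDiff ℝ ∞ B := contDiff_integral_of_contDiff hAs
  -- The double primitive of `θ`, corrected by a linear function so as to vanish at `1` as well.
  set Φ : ℝ → ℝ := fun x => B x - x * B 1 with hΦ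
  have hΦs : ContDiff ℝ ∞ Φ := hBs.sub (contDiff_id.mul contDiff_const)
  have hd : deriv Φ = fun x => A x - B 1 := by
    ext x
    exact (((hasDerivAt_integral_of_contDiff hAs x).sub
      ((hasDerivAt_id' x).mul_const (B 1))).congr_deriv (by ring)).deriv
  have hdd : deriv (deriv Φ) = θ := by
    rw [hd]
    ext x
    exact ((hasDerivAt_integral_of_contDiff hθ x).sub_const (B 1)).deriv
  have hΦ0 : Φ 0 = 0 := by simp [hΦ, hB]
  have hΦ1 : Φ 1 = 0 := by simp [hΦ]
  have key := integral_mul_deriv_deriv_of_zeroMeanTrace (R := fun x => - R x) hW hR.neg htr htr'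
    (fun η h1 h2 h3 => by
      rw [H η h1 h2 h3, ← integral_neg]; congr 1 with x; ring) hΦs hΦ0 hΦ1
  rw [hdd] at key
  rw [key]
  refine setIntegral_congr_fun measurableSet_Ioo fun y hy => ?_
  have := integral_greenKernel_mul_deriv_deriv hΦs hΦ0 hΦ1 hy
  rw [hdd] at this
  simp only [this]
  ring

/-- The kernel of integration from `0`: `1` if `p.2 < p.1`, and `0` otherwise. -/
noncomputable def primitiveKernel (p : ℝ × ℝ) : ℝ := {q : ℝ × ℝ | q.2 < q.1}.indicator 1 p

lemma measurable_primitiveKernel : Measurable primitiveKernel :=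
  measurable_one.indicator (measurableSet_lt measurable_snd measurable_fst)

lemma norm_primitiveKernel_le (p : ℝ × ℝ) : ‖primitiveKernel p‖ ≤ 1 := by
  refine (norm_indicator_le_norm_self _ _).trans ?_
  simp

/-- The test function is the primitive of `ζ` normalised to vanish at `T`, that is `s ↦ -∫ₛᵀ ζ`. It
vanishes near `T`, so only the trace of `W` at `0` enters and nothing is required at the final time.
-/
lemma integral_mul_eq_primitiveKernel {T : ℝ} {W G ζ : ℝ → ℝ}
    (hW : IntegrableOn W (Ioo 0 T)) (hG : IntegrableOn G (Ioo 0 T)) (htr : ZeroMeanTrace T W)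
    (H : ∀ η : ℝ → ℝ, ContDiff ℝ ∞ η → HasCompactSupport η → tsupport η ⊆ Ioo 0 T →
      ∫ x in Ioo 0 T, W x * deriv η x = - ∫ x in Ioo 0 T, G x * η x)
    (hζ : ContDiff ℝ ∞ ζ) (hζs : tsupport ζ ⊆ Ioo 0 T) :
    ∫ x in Ioo 0 T, W x * ζ x
      = ∫ s in Ioo 0 T, G s * ∫ t in Ioo 0 T, primitiveKernel (t, s) * ζ t := by
  set φ : ℝ → ℝ := fun x => (∫ y in (0 : ℝ)..x, ζ y) - ∫ y in (0 : ℝ)..T, ζ y with hφ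
  have hφs : ContDiff ℝ ∞ φ := (contDiff_integral_of_contDiff hζ).sub contDiff_const
  have hd : deriv φ = ζ := by
    ext x
    exact ((hasDerivAt_integral_of_contDiff hζ x).sub_const _).deriv
  have hφe : ∀ s, φ s = - ∫ t in s..T, ζ t := fun s => by
    have := intervalIntegral.integral_add_adjacent_intervals
      (hζ.continuous.intervalIntegrable (μ := volume) 0 s)
      (hζ.continuous.intervalIntegrable (μ := volume) s T)
    simp only [hφ]
    linarith
  have hsupp : tsupport φ ⊆ Iio T := by
    rcases (tsupport ζ).eq_empty_or_nonempty with he | hne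
    · have hz : ∀ x, ζ x = 0 := fun x => image_eq_zero_of_notMem_tsupport (by simp [he])
      have : φ = fun _ => 0 := by ext x; simp [hφ, hz]
      rw [this]
      simp [tsupport]
    -- The support of `ζ` is compact, so its largest point `c` is below `T`, and the primitive
    -- vanishes beyond `c`.
    · obtain ⟨c, hc, hmax⟩ := (hasCompactSupport_of_tsupport_subset_Ioo hζs).exists_isGreatest hne
      have h1 : tsupport φ ⊆ Iic c := by
        refine closure_minimal (fun x hx => ?_) isClosed_Iic
        by_contra hlt
        have hcx : c < x := not_le.1 hlt
        refine hx ?_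
        rw [hφe, neg_eq_zero]
        have hz : ∀ t ∈ uIcc x T, ζ t = 0 := fun t ht => by
          refine image_eq_zero_of_notMem_tsupport fun htm => ?_
          have h3 := hmax htm
          have h4 := (hζs hc).2
          rcases inf_le_iff.1 ht.1 with h | h <;> linarith
        rw [intervalIntegral.integral_congr (g := fun _ => (0 : ℝ)) hz]
        simp
      exact h1.trans fun x hx => lt_of_le_of_lt hx (hζs hc).2
  have key := integral_mul_deriv_of_zeroMeanTrace hW hG htr H hφs hsupp
  rw [hd] at key
  rw [key, ← integral_neg]
  refine setIntegral_congr_fun measurableSet_Ioo fun s hs => ?_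
  have e : ∫ t in Ioo 0 T, primitiveKernel (t, s) * ζ t = ∫ t in s..T, ζ t := by
    rw [intervalIntegral.integral_of_le hs.2.le, integral_Ioc_eq_integral_Ioo]
    have : (fun t => primitiveKernel (t, s) * ζ t) = (Ioi s).indicator ζ := by
      ext t
      by_cases h : s < t
      · simp [primitiveKernel, indicator, h]
      · simp [primitiveKernel, indicator, h]
    rw [this, setIntegral_indicator measurableSet_Ioi]
    congr 2
    ext t
    simp only [mem_inter_iff, mem_Ioo, mem_Ioi]
    constructor
    · rintro ⟨⟨_, h2⟩, h3⟩; exact ⟨h3, h2⟩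
    · rintro ⟨h1, h2⟩; exact ⟨⟨hs.1.trans h1, h2⟩, h1⟩
  simp only [e, hφe]
  ring

/-! ### From functions of two variables to their averages in one variable -/

lemma zeroMeanTrace_integral {T S C : ℝ} {u : ℝ × ℝ → ℝ} {η : ℝ → ℝ}
    (hu : IntegrableOn u (Ioo 0 T ×ˢ Ioo 0 S)) (hη : ∀ t, ‖η t‖ ≤ C)
    (htr : Tendsto (fun h : ℝ => (ENNReal.ofReal h)⁻¹ *
      ∫⁻ p in (Ioo 0 T ∩ Iio h) ×ˢ Ioo 0 S, ‖u p‖ₑ) (𝓝[>] 0) (𝓝 0)) :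
    ZeroMeanTrace T (fun x => ∫ t in Ioo 0 S, u (x, t) * η t) := by
  have h1 : Tendsto (fun h : ℝ => ((ENNReal.ofReal h)⁻¹ *
      ∫⁻ p in (Ioo 0 T ∩ Iio h) ×ˢ Ioo 0 S, ‖u p‖ₑ).toReal * C) (𝓝[>] 0) (𝓝 0) := by
    have := ((ENNReal.tendsto_toReal ENNReal.zero_ne_top).comp htr).mul_const C
    simpa using this
  refine squeeze_zero' ?_ ?_ h1
  · filter_upwards [self_mem_nhdsWithin] with h hh
    have : (0 : ℝ) < h := hh
    positivity
  filter_upwards [self_mem_nhdsWithin] with h hh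
  have hh' : (0 : ℝ) < h := hh
  rw [ENNReal.toReal_mul, ENNReal.toReal_inv, ENNReal.toReal_ofReal hh'.le, mul_assoc]
  refine mul_le_mul_of_nonneg_left ?_ (inv_nonneg.2 hh'.le)
  have hsub : IntegrableOn u ((Ioo 0 T ∩ Iio h) ×ˢ Ioo 0 S) :=
    hu.mono_set (Set.prod_mono inter_subset_left subset_rfl)
  rw [← integral_norm_eq_lintegral_enorm hsub.aestronglyMeasurable, ← integral_mul_const]
  have hprod : (volume : Measure (ℝ × ℝ)).restrict ((Ioo 0 T ∩ Iio h) ×ˢ Ioo 0 S)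
      = (volume.restrict (Ioo 0 T ∩ Iio h)).prod (volume.restrict (Ioo 0 S)) := by
    rw [Measure.prod_restrict]; rfl
  have hC : 0 ≤ C := (norm_nonneg _).trans (hη 0)
  rw [IntegrableOn, hprod] at hsub
  rw [hprod, integral_prod _ (hsub.norm.mul_const C)]
  refine integral_mono_of_nonneg (Eventually.of_forall fun x => abs_nonneg _)
    (hsub.norm.mul_const C).integral_prod_left ?_
  filter_upwards [(hsub.norm.mul_const C).prod_right_ae] with x hx
  change ‖∫ t in Ioo 0 S, u (x, t) * η t‖ ≤ _
  refine norm_integral_le_of_norm_le hx (Eventually.of_forall fun t => ?_)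
  rw [norm_mul]
  exact mul_le_mul_of_nonneg_left (hη t) (norm_nonneg _)

lemma volume_restrict_prod (A B : Set ℝ) : (volume : Measure (ℝ × ℝ)).restrict (A ×ˢ B)
    = (volume.restrict A).prod (volume.restrict B) := by
  rw [Measure.prod_restrict]; rfl

lemma IntegrableOn.mul_test {A B : Set ℝ} {u : ℝ × ℝ → ℝ} {θ η : ℝ → ℝ}
    (hu : IntegrableOn u (A ×ˢ B)) (hθ : Continuous θ) (hθc : HasCompactSupport θ)
    (hη : Continuous η) (hηc : HasCompactSupport η) :
    IntegrableOn (fun p => u p * (θ p.1 * η p.2)) (A ×ˢ B) := by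
  obtain ⟨C, hC⟩ := hθc.exists_bound_of_continuous hθ
  obtain ⟨D, hD⟩ := hηc.exists_bound_of_continuous hη
  refine Integrable.mul_bdd (c := C * D) hu ?_ (Eventually.of_forall fun p => ?_)
  · exact ((hθ.comp continuous_fst).mul (hη.comp continuous_snd)).aestronglyMeasurable
  · rw [norm_mul]
    exact mul_le_mul (hC _) (hD _) (norm_nonneg _) ((norm_nonneg _).trans (hC 0))

lemma setIntegral_prod_mul_test {A B : Set ℝ} {u : ℝ × ℝ → ℝ} {θ η : ℝ → ℝ}
    (hu : IntegrableOn u (A ×ˢ B)) (hθ : Continuous θ) (hθc : HasCompactSupport θ)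
    (hη : Continuous η) (hηc : HasCompactSupport η) :
    ∫ p in A ×ˢ B, u p * (θ p.1 * η p.2) = ∫ x in A, (∫ t in B, u (x, t) * η t) * θ x := by
  have h := IntegrableOn.mul_test hu hθ hθc hη hηc
  rw [IntegrableOn, volume_restrict_prod] at h
  rw [volume_restrict_prod, integral_prod _ h]
  congr 1 with x
  rw [← integral_mul_const]
  congr 1 with t
  ring

lemma IntegrableOn.integral_mul_test {A B : Set ℝ} {u : ℝ × ℝ → ℝ} {η : ℝ → ℝ}
    (hu : IntegrableOn u (A ×ˢ B)) (hη : Continuous η) (hηc : HasCompactSupport η) :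
    IntegrableOn (fun x => ∫ t in B, u (x, t) * η t) A := by
  obtain ⟨C, hC⟩ := hηc.exists_bound_of_continuous hη
  rw [IntegrableOn, volume_restrict_prod] at hu
  have : Integrable (fun p : ℝ × ℝ => u p * η p.2)
      ((volume.restrict A).prod (volume.restrict B)) :=
    hu.mul_bdd (c := C) (hη.comp continuous_snd).aestronglyMeasurable
      (Eventually.of_forall fun p => hC _)
  exact this.integral_prod_left

/-- Averaging against `η(t)` gives a function of `x` alone, to which the one-dimensional
representation applies; since `η` and `θ` are arbitrary, `ae_eq_kernel_of_test` returns to almost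
every point of the rectangle. The time representation below has the same structure. -/
lemma ae_eq_greenKernel_integral {T : ℝ} {u f : ℝ × ℝ → ℝ}
    (hu : IntegrableOn u (Ioo 0 1 ×ˢ Ioo 0 T)) (hf : IntegrableOn f (Ioo 0 1 ×ˢ Ioo 0 T))
    (htr : ∀ η : ℝ → ℝ, Continuous η → HasCompactSupport η →
      ZeroMeanTrace 1 (fun x => ∫ t in Ioo 0 T, u (x, t) * η t))
    (htr' : ∀ η : ℝ → ℝ, Continuous η → HasCompactSupport η →
      ZeroMeanTrace 1 (fun x => ∫ t in Ioo 0 T, u (1 - x, t) * η t))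
    (H : ∀ φ η : ℝ → ℝ, ContDiff ℝ ∞ φ → HasCompactSupport φ → tsupport φ ⊆ Ioo 0 1 →
      ContDiff ℝ ∞ η → HasCompactSupport η → tsupport η ⊆ Ioo 0 T →
      ∫ p in Ioo 0 1 ×ˢ Ioo 0 T, u p * (deriv (deriv φ) p.1 * η p.2)
        = - ∫ p in Ioo 0 1 ×ˢ Ioo 0 T, f p * (φ p.1 * η p.2)) :
    ∀ᵐ p ∂(volume.restrict (Ioo 0 1 ×ˢ Ioo 0 T)),
      u p = ∫ y in Ioo 0 1, greenKernel (p.1, y) * f (y, p.2) := by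
  rw [volume_restrict_prod]
  refine ae_eq_kernel_of_test (M := 1) continuous_greenKernel.measurable
    (fun x hx y hy => norm_greenKernel_le hx hy) (by rwa [← volume_restrict_prod])
    (by rwa [← volume_restrict_prod]) fun θ η hθ hθc hθs hη hηc hηs => ?_
  refine integral_mul_eq_greenKernel (IntegrableOn.integral_mul_test hu hη.continuous hηc)
    (IntegrableOn.integral_mul_test hf hη.continuous hηc) (htr η hη.continuous hηc)
    (htr' η hη.continuous hηc) (fun φ hφ hφc hφs => ?_) hθ
  have hφ' := (contDiff_infty_iff_deriv.1 hφ).2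
  have hφ'' := (contDiff_infty_iff_deriv.1 hφ').2
  rw [← setIntegral_prod_mul_test hu hφ''.continuous hφc.deriv.deriv hη.continuous hηc,
    ← setIntegral_prod_mul_test hf hφ.continuous hφc hη.continuous hηc, H φ η hφ hφc hφs hη hηc hηs]

lemma ae_eq_primitiveKernel_integral {T a b : ℝ} {u g : ℝ × ℝ → ℝ}
    (hu : IntegrableOn u (Ioo 0 T ×ˢ Ioo a b)) (hg : IntegrableOn g (Ioo 0 T ×ˢ Ioo a b))
    (htr : ∀ η : ℝ → ℝ, Continuous η → HasCompactSupport η →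
      ZeroMeanTrace T (fun t => ∫ x in Ioo a b, u (t, x) * η x))
    (H : ∀ η φ : ℝ → ℝ, ContDiff ℝ ∞ η → HasCompactSupport η → tsupport η ⊆ Ioo 0 T →
      ContDiff ℝ ∞ φ → HasCompactSupport φ → tsupport φ ⊆ Ioo a b →
      ∫ p in Ioo 0 T ×ˢ Ioo a b, u p * (deriv η p.1 * φ p.2)
        = - ∫ p in Ioo 0 T ×ˢ Ioo a b, g p * (η p.1 * φ p.2)) :
    ∀ᵐ p ∂(volume.restrict (Ioo 0 T ×ˢ Ioo a b)),
      u p = ∫ s in Ioo 0 T, primitiveKernel (p.1, s) * g (s, p.2) := by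
  rw [volume_restrict_prod]
  refine ae_eq_kernel_of_test (M := 1) measurable_primitiveKernel
    (fun x hx y hy => norm_primitiveKernel_le _) (by rwa [← volume_restrict_prod])
    (by rwa [← volume_restrict_prod]) fun θ η hθ hθc hθs hη hηc hηs => ?_
  refine integral_mul_eq_primitiveKernel (IntegrableOn.integral_mul_test hu hη.continuous hηc)
    (IntegrableOn.integral_mul_test hg hη.continuous hηc) (htr η hη.continuous hηc)
    (fun φ hφ hφc hφs => ?_) hθ hθs
  have hφ' := (contDiff_infty_iff_deriv.1 hφ).2
  rw [← setIntegral_prod_mul_test hu hφ'.continuous hφc.deriv hη.continuous hηc,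
    ← setIntegral_prod_mul_test hg hφ.continuous hφc hη.continuous hηc, H φ η hφ hφc hφs hη hηc hηs]

/-! ### The time derivative of the energy -/

/-- Translation acts continuously on `L²`, and the integral is the inner product of the two
translates restricted to `S`, hence jointly continuous in the two shifts. -/
lemma tendsto_setIntegral_translate {f g : ℝ × ℝ → ℝ} (hf : MemLp f 2 volume)
    (hg : MemLp g 2 volume) (S : Set (ℝ × ℝ)) :
    Tendsto (fun q : ℝ × ℝ => ∫ p in S, f (p.1, p.2 + q.1) * g (p.1, p.2 + q.2)) (𝓝 0)
      (𝓝 (∫ p in S, f p * g p)) := by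
  have : Fact ((2 : ℝ≥0∞) ≠ ⊤) := ⟨by simp⟩
  let ρ := LpToLpRestrictCLM (ℝ × ℝ) ℝ ℝ (volume : Measure (ℝ × ℝ)) 2 S
  have hval : ∀ (F : ℝ × ℝ → ℝ) (hF : MemLp F 2 volume) (h : ℝ),
      (ρ (DomAddAct.mk ((0, h) : ℝ × ℝ) +ᵥ hF.toLp F) : ℝ × ℝ → ℝ)
        =ᵐ[volume.restrict S] fun p => F (p.1, p.2 + h) := by
    intro F hF h
    refine (LpToLpRestrictCLM_coeFn ℝ S _).trans (ae_restrict_of_ae ?_)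
    rw [DomAddAct.mk_vadd_toLp]
    filter_upwards [(hF.comp_measurePreserving
      (measurePreserving_vadd ((0, h) : ℝ × ℝ) volume)).coeFn_toLp] with p hp
    have e : ((0, h) : ℝ × ℝ) +ᵥ p = (p.1, p.2 + h) := by
      ext <;> simp [add_comm]
    refine hp.trans ?_
    rw [Function.comp_apply, e]
  have hcont : ∀ (F : ℝ × ℝ → ℝ) (hF : MemLp F 2 volume), Continuous fun h : ℝ =>
      ρ (DomAddAct.mk ((0, h) : ℝ × ℝ) +ᵥ hF.toLp F) := by
    intro F hF
    refine ρ.continuous.comp ?_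
    have hm : Continuous fun h : ℝ => DomAddAct.mk ((0, h) : ℝ × ℝ) :=
      DomAddAct.continuous_mk.comp (by fun_prop)
    exact hm.vadd continuous_const
  have hc : Continuous fun q : ℝ × ℝ =>
      inner ℝ (ρ (DomAddAct.mk ((0, q.2) : ℝ × ℝ) +ᵥ hg.toLp g))
        (ρ (DomAddAct.mk ((0, q.1) : ℝ × ℝ) +ᵥ hf.toLp f)) :=
    ((hcont g hg).comp continuous_snd).inner ((hcont f hf).comp continuous_fst)
  have e : ∀ q : ℝ × ℝ, inner ℝ (ρ (DomAddAct.mk ((0, q.2) : ℝ × ℝ) +ᵥ hg.toLp g))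
        (ρ (DomAddAct.mk ((0, q.1) : ℝ × ℝ) +ᵥ hf.toLp f))
      = ∫ p in S, f (p.1, p.2 + q.1) * g (p.1, p.2 + q.2) := by
    intro q
    rw [L2.inner_def]
    refine integral_congr_ae ?_
    filter_upwards [hval f hf q.1, hval g hg q.2] with p h1 h2
    rw [h1, h2]
    simp
  have := hc.tendsto 0
  simp only [e] at this
  simpa using this

lemma MemLp.ae_memLp_left {f : ℝ × ℝ → ℝ} (hf : MemLp f 2 volume) :
    ∀ᵐ t : ℝ, MemLp (fun x => f (x, t)) 2 volume := by
  have h1 := hf.integrable_sq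
  rw [Measure.volume_eq_prod] at h1
  have h2 : AEStronglyMeasurable f ((volume : Measure ℝ).prod volume) := by
    rw [← Measure.volume_eq_prod]; exact hf.aestronglyMeasurable
  filter_upwards [h1.prod_left_ae, h2.prodMk_right] with t h3 h4
  exact (memLp_two_iff_integrable_sq h4).2 h3

/-- The shear `(r, (x, t)) ↦ (r, (x, t + r))` preserves the product measure, so both factors are in
`L²` of the product and their product is integrable. This justifies Fubini in the shift variable. -/
lemma MemLp.integrable_mul_translate {F g : ℝ × ℝ → ℝ} {μ : Measure (ℝ × ℝ)}
    (hF : MemLp F 2 volume) (hg : MemLp g 2 volume) (h : ℝ) (hμ : μ ≤ volume) [SFinite μ] :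
    Integrable (fun q : ℝ × (ℝ × ℝ) => F q.2 * g (q.2.1, q.2.2 + q.1))
      ((volume.restrict (Ioc 0 h)).prod μ) := by
  have m : MeasurePreserving (fun q : ℝ × (ℝ × ℝ) => (q.1, (q.2.1, q.2.2 + q.1)))
      ((volume.restrict (Ioc 0 h)).prod (volume : Measure (ℝ × ℝ)))
      ((volume.restrict (Ioc 0 h)).prod (volume : Measure (ℝ × ℝ))) := by
    refine (MeasurePreserving.id (volume.restrict (Ioc 0 h))).skew_product
      (g := fun r (p : ℝ × ℝ) => (p.1, p.2 + r)) (by fun_prop) (ae_of_all _ fun r => ?_)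
    have := (measurePreserving_add_right (volume : Measure (ℝ × ℝ)) (0, r)).map_eq
    have e : (fun p : ℝ × ℝ => (p.1, p.2 + r)) = fun p => p + (0, r) := by
      ext p <;> simp
    rw [e, this]
  have i1 : MemLp (fun q : ℝ × (ℝ × ℝ) => F q.2) 2
      ((volume.restrict (Ioc 0 h)).prod (volume : Measure (ℝ × ℝ))) := hF.comp_snd _
  have i2 : MemLp (fun q : ℝ × (ℝ × ℝ) => g (q.2.1, q.2.2 + q.1)) 2
      ((volume.restrict (Ioc 0 h)).prod (volume : Measure (ℝ × ℝ))) :=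
    (hg.comp_snd (volume.restrict (Ioc 0 h))).comp_measurePreserving m
  exact (i1.integrable_mul i2).mono_measure (Measure.prod_mono le_rfl hμ)

lemma tendsto_inv_mul_setIntegral {ψ : ℝ × ℝ → ℝ} {c b : ℝ} (hb : 0 < b)
    (hψ : Tendsto ψ (𝓝 0) (𝓝 c)) (hi : ∀ h ∈ Ioo 0 b, IntegrableOn (fun r => ψ (h, r)) (Ioc 0 h)) :
    Tendsto (fun h => h⁻¹ * ∫ r in Ioc 0 h, ψ (h, r)) (𝓝[>] 0) (𝓝 c) := by
  rw [Metric.tendsto_nhds]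
  intro ε hε
  obtain ⟨δ, hδ, hδψ⟩ := Metric.tendsto_nhds_nhds.1 hψ (ε / 2) (half_pos hε)
  filter_upwards [Ioo_mem_nhdsGT hb, Ioo_mem_nhdsGT hδ] with h hh hh'
  have e : h⁻¹ * (∫ r in Ioc 0 h, ψ (h, r)) - c = h⁻¹ * ∫ r in Ioc 0 h, (ψ (h, r) - c) := by
    rw [integral_sub (hi h hh) (integrableOn_const (by simp))]
    simp only [integral_const, smul_eq_mul, MeasurableSet.univ, measureReal_restrict_apply,
      univ_inter, Real.volume_real_Ioc, sub_zero, max_eq_left hh.1.le]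
    have := hh.1.ne'
    field_simp
  have bound : ‖∫ r in Ioc 0 h, (ψ (h, r) - c)‖ ≤ ε / 2 * h := by
    have := norm_setIntegral_le_of_norm_le_const (μ := volume) (s := Ioc 0 h) (C := ε / 2)
      (f := fun r => ψ (h, r) - c) (by simp) fun r hr => by
        have hd : dist (h, r) (0 : ℝ × ℝ) < δ := by
          rw [Prod.dist_eq, max_lt_iff]
          refine ⟨?_, ?_⟩
          · simpa [abs_of_pos hh.1] using hh'.2
          · simpa [abs_of_pos hr.1] using hr.2.trans_lt hh'.2
        exact (hδψ hd).le
    simpa [Real.volume_real_Ioc, max_eq_left hh.1.le] using this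
  rw [Real.dist_eq, e, abs_mul, abs_of_pos (inv_pos.2 hh.1)]
  rw [Real.norm_eq_abs] at bound
  calc h⁻¹ * |∫ r in Ioc 0 h, (ψ (h, r) - c)| ≤ h⁻¹ * (ε / 2 * h) :=
        mul_le_mul_of_nonneg_left bound (inv_pos.2 hh.1).le
    _ = ε / 2 := by have := hh.1.ne'; field_simp
    _ < ε := half_lt_self hε

lemma MemLp.translate {f : ℝ × ℝ → ℝ} (hf : MemLp f 2 volume) (h : ℝ) :
    MemLp (fun p : ℝ × ℝ => f (p.1, p.2 + h)) 2 volume := by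
  have := hf.comp_measurePreserving (measurePreserving_add_right (volume : Measure (ℝ × ℝ)) (0, h))
  convert this using 1
  ext p
  simp only [Function.comp]
  congr 1
  ext <;> simp

/-- If `u` is the primitive in time of `g`, and `f = A u` with `A` symmetric, then
`d/dt ⟨f, u⟩ = 2 ⟨f, g⟩`. -/
lemma ae_integral_mul_eq_of_symmetric {T : ℝ} {f g u : ℝ × ℝ → ℝ} (hf : MemLp f 2 volume)
    (hg : MemLp g 2 volume) (hu : MemLp u 2 volume) (hg1 : ∀ᵐ x : ℝ, Integrable fun s => g (x, s))
    (hug : ∀ᵐ t : ℝ, t < T → ∀ᵐ x : ℝ, u (x, t) = ∫ s in Iic t, g (x, s))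
    {G : Set ℝ} (hG : ∀ᵐ t : ℝ, t < T → t ∈ G)
    (hsym : ∀ s ∈ G, ∀ t ∈ G, ∫ x, f (x, s) * u (x, t) = ∫ x, f (x, t) * u (x, s)) :
    ∀ᵐ τ : ℝ, τ < T → ∫ x, f (x, τ) * u (x, τ)
      = ∫ t in Iic τ, ∫ x, 2 * (f (x, t) * g (x, t)) := by
  set D : ℝ → ℝ := fun t => ∫ x, f (x, t) * u (x, t) with hDdef
  have hD : Integrable D := by
    have := hf.integrable_mul hu
    rw [Measure.volume_eq_prod] at this
    exact this.integral_prod_right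
  -- At almost every `τ`, `D τ` is the limit of the means of `D` over `(τ, τ + h)`; the other side
  -- of the identity is found by computing these means differently.
  filter_upwards [LocallyIntegrable.ae_hasDerivAt_integral hD.locallyIntegrable] with τ hτ hτT
  set S : Set (ℝ × ℝ) := univ ×ˢ Iic τ with hS
  have hμS : (volume : Measure (ℝ × ℝ)).restrict S
      = (volume : Measure ℝ).prod (volume.restrict (Iic τ)) := by
    rw [hS, volume_restrict_prod, Measure.restrict_univ]
  have l1 : Tendsto (fun h => h⁻¹ * ∫ t in τ..(τ + h), D t) (𝓝[>] 0) (𝓝 (D τ)) := by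
    simpa using (hτ τ).tendsto_slope_zero_right
  have hT : 0 < T - τ := sub_pos.2 hτT
  -- The first argument is the time step applied to `f`; the second is the shift inside the
  -- increment of `u`, over which one averages. At the origin the value is `2 ∫ f g` over times up
  -- to `τ`.
  set ψ : ℝ × ℝ → ℝ := fun q => (∫ p in S, f (p.1, p.2 + q.1) * g (p.1, p.2 + q.2))
    + ∫ p in S, f (p.1, p.2 + 0) * g (p.1, p.2 + q.2) with hψ
  have l2 : Tendsto ψ (𝓝 0) (𝓝 ((∫ p in S, f p * g p) + ∫ p in S, f p * g p)) := by
    have a1 := tendsto_setIntegral_translate hf hg S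
    refine a1.add (a1.comp (f := fun q : ℝ × ℝ => ((0, q.2) : ℝ × ℝ)) ?_)
    have : Continuous fun q : ℝ × ℝ => ((0, q.2) : ℝ × ℝ) := by fun_prop
    exact this.tendsto' 0 0 rfl
  have hi : ∀ h : ℝ, Integrable (fun q : ℝ × (ℝ × ℝ) =>
      (f (q.2.1, q.2.2 + h) + f (q.2.1, q.2.2 + 0)) * g (q.2.1, q.2.2 + q.1))
      ((volume.restrict (Ioc 0 h)).prod (volume.restrict S)) := fun h =>
    MemLp.integrable_mul_translate ((MemLp.translate hf h).add (MemLp.translate hf 0)) hg h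
      Measure.restrict_le_self
  have hψe : ∀ q : ℝ × ℝ, ψ q
      = ∫ p in S, (f (p.1, p.2 + q.1) + f (p.1, p.2 + 0)) * g (p.1, p.2 + q.2) := by
    intro q
    simp only [hψ]
    rw [← integral_add]
    · congr 1 with p; ring
    · exact ((MemLp.translate hf q.1).integrable_mul (MemLp.translate hg q.2)).mono_measure
        Measure.restrict_le_self
    · exact ((MemLp.translate hf 0).integrable_mul (MemLp.translate hg q.2)).mono_measure
        Measure.restrict_le_self
  have l3 := tendsto_inv_mul_setIntegral hT l2 fun h _ => by
    simp only [hψe]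
    exact (hi h).integral_prod_left
  have hrhs : ∫ t in Iic τ, ∫ x, 2 * (f (x, t) * g (x, t))
      = (∫ p in S, f p * g p) + ∫ p in S, f p * g p := by
    have hfg : Integrable (fun p => f p * g p)
        ((volume : Measure ℝ).prod (volume.restrict (Iic τ))) := by
      rw [← hμS]
      exact (hf.integrable_mul hg).mono_measure Measure.restrict_le_self
    rw [hμS, integral_prod_symm _ hfg]
    simp only [integral_const_mul]
    ring
  rw [hrhs]
  refine tendsto_nhds_unique l1 (l3.congr' ?_)
  filter_upwards [Ioo_mem_nhdsGT hT] with h hh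
  congr 1
  have g1 : ∀ᵐ t : ℝ, t < T → (t ∈ G ∧ MemLp (fun x => f (x, t)) 2 volume ∧
      MemLp (fun x => u (x, t)) 2 volume ∧ ∀ᵐ x : ℝ, u (x, t) = ∫ s in Iic t, g (x, s)) := by
    filter_upwards [hG, MemLp.ae_memLp_left hf, MemLp.ae_memLp_left hu, hug] with t h1 h2 h3 h4 h5
    exact ⟨h1 h5, h2, h3, h4 h5⟩
  have g2 := (measurePreserving_add_right (volume : Measure ℝ) h).quasiMeasurePreserving.ae g1
  -- By symmetry the cross terms of `(f(t+h) + f(t)) (u(t+h) - u(t))` cancel after integration in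
  -- `x`, leaving `D (t + h) - D t`. Only the increment of `u` remains, and it is an integral of
  -- `g`; `f` is never differenced.
  have key : ∀ᵐ t ∂(volume.restrict (Iic τ)), D (t + h) - D t
      = ∫ x, ∫ r in Ioc 0 h, (f (x, t + h) + f (x, t + 0)) * g (x, t + r) := by
    filter_upwards [ae_restrict_of_ae g1, ae_restrict_of_ae g2,
      ae_restrict_mem measurableSet_Iic] with t h1 h2 ht
    have ht' : t ≤ τ := ht
    obtain ⟨tG, tf, tu, tp⟩ := h1 (by linarith)
    obtain ⟨sG, sf, su, sp⟩ := h2 (by linarith [hh.2])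
    have e1 : D (t + h) - D t
        = ∫ x, (f (x, t + h) + f (x, t)) * (u (x, t + h) - u (x, t)) := by
      have hs := hsym (t + h) sG t tG
      have i1 : Integrable fun x => f (x, t + h) * u (x, t + h) := sf.integrable_mul su
      have i2 : Integrable fun x => f (x, t + h) * u (x, t) := sf.integrable_mul tu
      have i3 : Integrable fun x => f (x, t) * u (x, t + h) := tf.integrable_mul su
      have i4 : Integrable fun x => f (x, t) * u (x, t) := tf.integrable_mul tu
      have : ∫ x, (f (x, t + h) + f (x, t)) * (u (x, t + h) - u (x, t))
          = ((∫ x, f (x, t + h) * u (x, t + h)) - ∫ x, f (x, t + h) * u (x, t))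
            + ((∫ x, f (x, t) * u (x, t + h)) - ∫ x, f (x, t) * u (x, t)) := by
        have i5 : Integrable fun x => f (x, t + h) * u (x, t + h) - f (x, t + h) * u (x, t) :=
          i1.sub i2
        have i6 : Integrable fun x => f (x, t) * u (x, t + h) - f (x, t) * u (x, t) := i3.sub i4
        rw [← integral_sub i1 i2, ← integral_sub i3 i4, ← integral_add i5 i6]
        congr 1 with x
        ring
      rw [this, hs]
      simp only [hDdef]
      ring
    rw [e1]
    refine integral_congr_ae ?_
    filter_upwards [tp, sp, hg1] with x x1 x2 x3
    rw [x1, x2, integral_const_mul, add_zero,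
      intervalIntegral.integral_Iic_sub_Iic x3.integrableOn x3.integrableOn]
    congr 1
    rw [← intervalIntegral.integral_of_le hh.1.le,
      intervalIntegral.integral_comp_add_left (fun s => g (x, s)) t, add_zero]
  -- Telescoping: the integral over the short interval becomes an integral of increments over all
  -- earlier times, thanks to the integrability of `D` on the line.
  have e2 : ∫ t in τ..(τ + h), D t = ∫ t in Iic τ, (D (t + h) - D t) := by
    have hDh : Integrable fun t => D (t + h) := hD.comp_add_right h
    rw [integral_sub hDh.integrableOn hD.integrableOn,
      ← intervalIntegral.integral_Iic_sub_Iic hD.integrableOn hD.integrableOn]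
    congr 1
    have := (measurePreserving_add_right (volume : Measure ℝ) h).setIntegral_preimage_emb
      (measurableEmbedding_addRight h) D (Iic (τ + h))
    rw [← this]
    simp
  have hi' := hi h
  have hi2 := hi'.integral_prod_right
  rw [e2, integral_congr_ae key]
  simp only [hψe]
  rw [← integral_prod _ hi', integral_prod_symm _ hi']
  rw [hμS] at hi2 ⊢
  rw [integral_prod_symm _ hi2]

/-! ### The weighted energy inequality -/

/-- With `U` the primitive of `g`, `w U²` is absolutely continuous and zero at `0`, so it is the
integral of its derivative `w' U² + 2 w U g`; the bound on `w'` is inserted there. -/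
lemma mul_sq_primitive_le {w κ g : ℝ → ℝ} {τ : ℝ} (hτ : 0 ≤ τ)
    (hw : AbsolutelyContinuousOnInterval w 0 τ) (hκ : Continuous κ)
    (hw' : ∀ᵐ t, t ∈ Ioo 0 τ → deriv w t ≤ -2 * κ t * w t)
    (hg : IntervalIntegrable g volume 0 τ) :
    w τ * (∫ s in (0 : ℝ)..τ, g s) ^ 2 ≤ ∫ t in (0 : ℝ)..τ,
      (-2 * κ t * w t * (∫ s in (0 : ℝ)..t, g s) ^ 2 + 2 * w t * (∫ s in (0 : ℝ)..t, g s) * g t) := by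
  set U : ℝ → ℝ := fun t => ∫ s in (0 : ℝ)..t, g s with hU
  have hUac : AbsolutelyContinuousOnInterval U 0 τ :=
    hg.absolutelyContinuousOnInterval_intervalIntegral left_mem_uIcc
  have hac := hw.fun_mul (hUac.fun_mul hUac)
  have h1 := hac.integral_deriv_eq_sub
  have hU0 : U 0 = 0 := by simp [hU]
  have e : w τ * U τ ^ 2 = ∫ t in (0 : ℝ)..τ, deriv (fun t => w t * (U t * U t)) t := by
    rw [h1, hU0]; ring
  change w τ * U τ ^ 2 ≤ ∫ t in (0 : ℝ)..τ, (-2 * κ t * w t * U t ^ 2 + 2 * w t * U t * g t)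
  rw [e]
  refine intervalIntegral.integral_mono_ae_restrict hτ hac.intervalIntegrable_deriv ?_ ?_
  · refine IntervalIntegrable.add ?_ ?_
    · refine ContinuousOn.intervalIntegrable ?_
      exact (((continuous_const.mul hκ).continuousOn).mul hw.continuousOn).mul
        (hUac.continuousOn.pow 2)
    · exact hg.continuousOn_mul ((continuousOn_const.mul hw.continuousOn).mul hUac.continuousOn)
  · have hend : ∀ᵐ t : ℝ, t ≠ τ := by simp [ae_iff, measure_singleton]
    have hend0 : ∀ᵐ t : ℝ, t ≠ 0 := by simp [ae_iff, measure_singleton]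
    filter_upwards [ae_restrict_of_ae hw.ae_differentiableAt,
      ae_restrict_of_ae hg.ae_hasDerivAt_integral, ae_restrict_of_ae hw',
      ae_restrict_mem measurableSet_Icc, ae_restrict_of_ae hend, ae_restrict_of_ae hend0]
      with t d1 d2 d3 ht ht1 ht0
    have htm : t ∈ uIcc 0 τ := by rwa [uIcc_of_le hτ]
    have D1 := (d1 htm).hasDerivAt
    have D2 : HasDerivAt U (g t) t := d2 htm 0 left_mem_uIcc
    have D3 := D1.fun_mul (D2.fun_mul D2)
    have ht' : t ∈ Ioo 0 τ := ⟨lt_of_le_of_ne ht.1 (Ne.symm ht0), lt_of_le_of_ne ht.2 ht1⟩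
    rw [D3.deriv]
    have := mul_le_mul_of_nonneg_right (d3 ht') (sq_nonneg (U t))
    nlinarith

lemma mul_primitive_eq {P P' d : ℝ → ℝ} {τ : ℝ} (hP : ∀ t, HasDerivAt P (P' t) t)
    (hP' : Continuous P') (hd : IntervalIntegrable d volume 0 τ) :
    P τ * (∫ s in (0 : ℝ)..τ, d s)
      = ∫ t in (0 : ℝ)..τ, (P' t * (∫ s in (0 : ℝ)..t, d s) + P t * d t) := by
  have hPd : deriv P = P' := funext fun t => (hP t).deriv
  have hPc : ContDiff ℝ 1 P := by
    rw [contDiff_one_iff_deriv, hPd]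
    exact ⟨fun t => (hP t).differentiableAt, hP'⟩
  have hPac : AbsolutelyContinuousOnInterval P 0 τ :=
    hPc.contDiffOn.absolutelyContinuousOnInterval
  have hUac : AbsolutelyContinuousOnInterval (fun t => ∫ s in (0 : ℝ)..t, d s) 0 τ :=
    hd.absolutelyContinuousOnInterval_intervalIntegral left_mem_uIcc
  have h := hPac.integral_deriv_mul_eq_sub hUac
  rw [intervalIntegral.integral_same, mul_zero, sub_zero] at h
  rw [← h]
  refine intervalIntegral.integral_congr_ae ?_
  filter_upwards [hd.ae_hasDerivAt_integral] with t ht htm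
  have := (ht (uIoc_subset_uIcc htm) 0 left_mem_uIcc).deriv
  rw [hPd, this]

/-- Weighted energy inequality behind backward uniqueness. -/
lemma weighted_energy_le {T C A : ℝ} {a f g u : ℝ × ℝ → ℝ} {κ P : ℝ → ℝ}
    (hκ0 : ∀ t, 0 ≤ κ t) (hP0 : ∀ t, 0 < P t)
    (hκ : ∀ t, HasDerivAt κ (-C * κ t) t) (hP : ∀ t, HasDerivAt P (-2 * κ t * P t) t)
    (hf : MemLp f 2 (volume.restrict (Ioo 0 1 ×ˢ Ioo 0 T)))
    (hg : MemLp g 2 (volume.restrict (Ioo 0 1 ×ˢ Ioo 0 T)))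
    (hu : MemLp u 2 (volume.restrict (Ioo 0 1 ×ˢ Ioo 0 T)))
    (ham : AEStronglyMeasurable a (volume.restrict (Ioo 0 1 ×ˢ Ioo 0 T)))
    (ha0 : ∀ p ∈ Ioo (0 : ℝ) 1 ×ˢ Ioo 0 T, 0 < a p) (haA : ∀ p ∈ Ioo (0 : ℝ) 1 ×ˢ Ioo 0 T, a p ≤ A)
    (hac : ∀ x ∈ Ioo (0 : ℝ) 1, ∀ τ ∈ Ioo 0 T,
      AbsolutelyContinuousOnInterval (fun t => a (x, t)) 0 τ)
    (had : ∀ x ∈ Ioo (0 : ℝ) 1, ∀ t ∈ Ioo 0 T, deriv (fun t => a (x, t)) t ≤ C * a (x, t))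
    (hfg : ∀ᵐ p ∂(volume.restrict (Ioo (0 : ℝ) 1 ×ˢ Ioo 0 T)), f p = a p * g p)
    (hug : ∀ᵐ p ∂(volume.restrict (Ioo (0 : ℝ) 1 ×ˢ Ioo 0 T)),
      u p = ∫ s in (0 : ℝ)..p.2, g (p.1, s))
    (hD : ∀ᵐ τ, τ ∈ Ioo 0 T → ∫ x in Ioo (0 : ℝ) 1, f (x, τ) * u (x, τ)
      = ∫ t in (0 : ℝ)..τ, ∫ x in Ioo (0 : ℝ) 1, 2 * (f (x, t) * g (x, t))) :
    ∀ᵐ τ ∂(volume.restrict (Ioo 0 T)), κ τ * ∫ x in Ioo (0 : ℝ) 1, a (x, τ) * u (x, τ) ^ 2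
      ≤ ∫ x in Ioo (0 : ℝ) 1, f (x, τ) * u (x, τ) := by
  have hB : MeasurableSet (Ioo (0 : ℝ) 1 ×ˢ Ioo 0 T) := measurableSet_Ioo.prod measurableSet_Ioo
  have hκc : Continuous κ := continuous_iff_continuousAt.2 fun t => (hκ t).continuousAt
  have hPc : Continuous P := continuous_iff_continuousAt.2 fun t => (hP t).continuousAt
  have hmem := ae_restrict_mem (μ := (volume : Measure (ℝ × ℝ))) hB
  have abd : ∀ᵐ p ∂(volume.restrict (Ioo (0 : ℝ) 1 ×ˢ Ioo 0 T)), ‖a p‖ ≤ A := by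
    filter_upwards [hmem] with p hp
    rw [Real.norm_of_nonneg (ha0 p hp).le]; exact haA p hp
  have ifu := hf.integrable_mul hu
  have ifg := hf.integrable_mul hg
  have iau : Integrable (fun p => a p * u p ^ 2) (volume.restrict (Ioo 0 1 ×ˢ Ioo 0 T)) :=
    hu.integrable_sq.bdd_mul ham abd
  have iaug : Integrable (fun p => a p * (u p * g p)) (volume.restrict (Ioo 0 1 ×ˢ Ioo 0 T)) :=
    (hu.integrable_mul hg).bdd_mul ham abd
  have ig : Integrable g (volume.restrict (Ioo 0 1 ×ˢ Ioo 0 T)) := by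
    have : IsFiniteMeasure ((volume : Measure (ℝ × ℝ)).restrict (Ioo 0 1 ×ˢ Ioo 0 T)) := by
      rw [volume_restrict_prod]; infer_instance
    exact hg.integrable (by norm_num)
  rw [volume_restrict_prod] at *
  set μ := (volume : Measure ℝ).restrict (Ioo 0 1) with hμ
  have swap_ae : ∀ {p : ℝ × ℝ → Prop}, (∀ᵐ z ∂(μ.prod (volume.restrict (Ioo 0 T))), p z) →
      ∀ᵐ t ∂(volume.restrict (Ioo 0 T)), ∀ᵐ x ∂μ, p (x, t) := by
    intro p hp
    have h := (Measure.measurePreserving_swap (μ := (volume.restrict (Ioo 0 T)))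
      (ν := μ)).quasiMeasurePreserving.ae hp
    exact Measure.ae_ae_of_ae_prod h
  have hDd : Integrable (fun t => ∫ x, 2 * (f (x, t) * g (x, t)) ∂μ)
      (volume.restrict (Ioo 0 T)) := (ifg.const_mul 2).integral_prod_right
  filter_upwards [swap_ae hug, (ae_restrict_iff' measurableSet_Ioo).2 hD,
    ae_restrict_mem measurableSet_Ioo, iau.prod_left_ae] with τ t1 t2 hτ iτ
  have hsub : Ioc 0 τ ⊆ Ioo 0 T := fun t ht => ⟨ht.1, ht.2.trans_lt hτ.2⟩
  have hle : (volume : Measure ℝ).restrict (Ioc 0 τ) ≤ volume.restrict (Ioo 0 T) :=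
    Measure.restrict_mono hsub le_rfl
  have hle2 : μ.prod ((volume : Measure ℝ).restrict (Ioc 0 τ))
      ≤ μ.prod (volume.restrict (Ioo 0 T)) := Measure.prod_mono le_rfl hle
  have habs2 : μ.prod ((volume : Measure ℝ).restrict (Ioc 0 τ))
      ≪ μ.prod (volume.restrict (Ioo 0 T)) := Measure.absolutelyContinuous_of_le hle2
  -- weights depending on time only are bounded on `[0, τ]`
  have wint : ∀ {F : ℝ × ℝ → ℝ} {m : ℝ → ℝ}, Continuous m →
      Integrable F (μ.prod (volume.restrict (Ioo 0 T))) →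
      Integrable (fun p => m p.2 * F p) (μ.prod (volume.restrict (Ioc 0 τ))) := by
    intro F m hm hF
    obtain ⟨M, hM⟩ := isCompact_Icc.exists_bound_of_continuousOn (s := Icc 0 τ) hm.continuousOn
    refine (hF.mono_measure hle2).bdd_mul (c := M)
      (hm.comp continuous_snd).aestronglyMeasurable ?_
    have : ∀ᵐ p ∂(μ.prod ((volume : Measure ℝ).restrict (Ioc 0 τ))), p.2 ∈ Ioc 0 τ :=
      Measure.quasiMeasurePreserving_snd.ae (ae_restrict_mem measurableSet_Ioc)
    filter_upwards [this] with p hp using hM _ (Ioc_subset_Icc_self hp)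
  set F : ℝ × ℝ → ℝ := fun p => (-2 * κ p.2 * P p.2) * (f p * u p)
    + P p.2 * (2 * (f p * g p)) with hF
  set E : ℝ × ℝ → ℝ := fun p => (-2 * κ p.2 * (κ p.2 * P p.2)) * (a p * u p ^ 2)
    + (2 * (κ p.2 * P p.2)) * (a p * (u p * g p)) with hE
  have iF : Integrable F (μ.prod (volume.restrict (Ioc 0 τ))) :=
    (wint (m := fun t => -2 * κ t * P t) (by fun_prop) ifu).add
      (wint (m := P) hPc (ifg.const_mul 2))
  have iE : Integrable E (μ.prod (volume.restrict (Ioc 0 τ))) :=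
    (wint (m := fun t => -2 * κ t * (κ t * P t)) (by fun_prop) iau).add
      (wint (m := fun t => 2 * (κ t * P t)) (by fun_prop) iaug)
  have hEF : ∫ p, E p ∂(μ.prod (volume.restrict (Ioc 0 τ)))
      ≤ ∫ p, F p ∂(μ.prod (volume.restrict (Ioc 0 τ))) := by
    refine integral_mono_ae iE iF ?_
    filter_upwards [habs2.ae_le hfg, habs2.ae_le hmem] with p h1 h2
    simp only [hE, hF, h1]
    -- After substituting `f = a g`, the difference of the integrands `F - E` is exactly this
    -- weighted square.
    have h3 : 0 ≤ P p.2 * (2 * a p * (g p - κ p.2 * u p) ^ 2) :=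
      mul_nonneg (hP0 _).le (mul_nonneg (mul_nonneg two_pos.le (ha0 p h2).le) (sq_nonneg _))
    nlinarith
  have hFD : ∫ p, F p ∂(μ.prod (volume.restrict (Ioc 0 τ)))
      = P τ * ∫ x, f (x, τ) * u (x, τ) ∂μ := by
    rw [t2, mul_primitive_eq hP (by fun_prop)
      ((intervalIntegrable_iff_integrableOn_Ioc_of_le hτ.1.le).2 (hDd.mono_measure hle)),
      integral_prod_symm _ iF, intervalIntegral.integral_of_le hτ.1.le]
    refine integral_congr_ae ?_
    have a1 := ae_mono hle ((ae_restrict_iff' measurableSet_Ioo).2 hD)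
    have a2 := ae_mono hle ifu.prod_left_ae
    have a3 := ae_mono hle ifg.prod_left_ae
    filter_upwards [a1, a2, a3, ae_restrict_mem measurableSet_Ioc] with t b1 b2 b3 ht
    have b2' : Integrable (fun x => f (x, t) * u (x, t)) μ := b2
    have b3' : Integrable (fun x => f (x, t) * g (x, t)) μ := b3
    rw [← b1]
    simp only [hF]
    rw [integral_add (b2'.const_mul _) ((b3'.const_mul 2).const_mul _), integral_const_mul,
      integral_const_mul]
  have hEl : κ τ * P τ * ∫ x, a (x, τ) * u (x, τ) ^ 2 ∂μ
      ≤ ∫ p, E p ∂(μ.prod (volume.restrict (Ioc 0 τ))) := by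
    rw [integral_prod _ iE, ← integral_const_mul]
    refine integral_mono_ae (iτ.const_mul _) iE.integral_prod_left ?_
    have c1 := Measure.ae_ae_of_ae_prod (habs2.ae_le hug)
    have c2 := ig.prod_right_ae
    filter_upwards [t1, c1, c2, ae_restrict_mem measurableSet_Ioo] with x x1 x2 x3 hx
    have hgi : IntervalIntegrable (fun s => g (x, s)) volume 0 τ :=
      (intervalIntegrable_iff_integrableOn_Ioc_of_le hτ.1.le).2 (x3.mono_measure hle)
    have hmc : ContDiff ℝ 1 fun t => κ t * P t := by
      have hd : ∀ t, HasDerivAt (fun t => κ t * P t) (-C * κ t * P t + κ t * (-2 * κ t * P t)) t :=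
        fun t => (hκ t).fun_mul (hP t)
      rw [contDiff_one_iff_deriv, funext fun t => (hd t).deriv]
      exact ⟨fun t => (hd t).differentiableAt, by fun_prop⟩
    have hw : AbsolutelyContinuousOnInterval (fun t => (κ t * P t) * a (x, t)) 0 τ :=
      (hmc.contDiffOn.absolutelyContinuousOnInterval).fun_mul (hac x hx τ hτ)
    have hle' := mul_sq_primitive_le (κ := κ) (g := fun s => g (x, s)) hτ.1.le hw hκc ?_ hgi
    · have x1' : u (x, τ) = ∫ s in (0 : ℝ)..τ, g (x, s) := x1
      simp only [x1']
      rw [← mul_assoc]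
      refine hle'.trans_eq ?_
      rw [intervalIntegral.integral_of_le hτ.1.le]
      refine integral_congr_ae ?_
      filter_upwards [x2] with t ht
      simp only [hE, ht]
      ring
    -- For the weight `κ P a`, the decay `κ' = -C κ` offsets the growth `a_t ≤ C a`, and `P' = -2 κ
    -- P` leaves the required rate `-2 κ`.
    · filter_upwards [(hac x hx τ hτ).ae_differentiableAt] with t d1 ht
      have d1' := (d1 (by rw [uIcc_of_le hτ.1.le]; exact Ioo_subset_Icc_self ht)).hasDerivAt
      have d2 := ((hκ t).fun_mul (hP t)).fun_mul d1'
      rw [d2.deriv]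
      have d3 := had x hx t ⟨ht.1, ht.2.trans hτ.2⟩
      have := mul_le_mul_of_nonneg_left d3 (mul_nonneg (hκ0 t) (hP0 t).le)
      nlinarith
  have hfin := hEl.trans (hEF.trans_eq hFD)
  have : P τ * (κ τ * ∫ x, a (x, τ) * u (x, τ) ^ 2 ∂μ) ≤ P τ * ∫ x, f (x, τ) * u (x, τ) ∂μ := by
    refine le_trans (le_of_eq ?_) hfin
    ring
  exact le_of_mul_le_mul_left this (hP0 τ)

/-- Backward uniqueness in terms of the energy identities. -/
lemma ae_eq_zero_of_energy {T C A : ℝ} {a f g u : ℝ × ℝ → ℝ} (hC : 0 < C)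
    (hf : MemLp f 2 (volume.restrict (Ioo 0 1 ×ˢ Ioo 0 T)))
    (hg : MemLp g 2 (volume.restrict (Ioo 0 1 ×ˢ Ioo 0 T)))
    (hu : MemLp u 2 (volume.restrict (Ioo 0 1 ×ˢ Ioo 0 T)))
    (ham : AEStronglyMeasurable a (volume.restrict (Ioo 0 1 ×ˢ Ioo 0 T)))
    (ha0 : ∀ p ∈ Ioo (0 : ℝ) 1 ×ˢ Ioo 0 T, 0 < a p) (haA : ∀ p ∈ Ioo (0 : ℝ) 1 ×ˢ Ioo 0 T, a p ≤ A)
    (hac : ∀ x ∈ Ioo (0 : ℝ) 1, ∀ τ ∈ Ioo 0 T,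
      AbsolutelyContinuousOnInterval (fun t => a (x, t)) 0 τ)
    (had : ∀ x ∈ Ioo (0 : ℝ) 1, ∀ t ∈ Ioo 0 T, deriv (fun t => a (x, t)) t ≤ C * a (x, t))
    (hfg : ∀ᵐ p ∂(volume.restrict (Ioo (0 : ℝ) 1 ×ˢ Ioo 0 T)), f p = a p * g p)
    (hug : ∀ᵐ p ∂(volume.restrict (Ioo (0 : ℝ) 1 ×ˢ Ioo 0 T)),
      u p = ∫ s in (0 : ℝ)..p.2, g (p.1, s))
    (hD : ∀ᵐ τ, τ ∈ Ioo 0 T → ∫ x in Ioo (0 : ℝ) 1, f (x, τ) * u (x, τ)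
      = ∫ t in (0 : ℝ)..τ, ∫ x in Ioo (0 : ℝ) 1, 2 * (f (x, t) * g (x, t))) :
    u =ᵐ[volume.restrict (Ioo 0 1 ×ˢ Ioo 0 T)] 0 := by
  have hB : MeasurableSet (Ioo (0 : ℝ) 1 ×ˢ Ioo 0 T) := measurableSet_Ioo.prod measurableSet_Ioo
  have hmem := ae_restrict_mem (μ := (volume : Measure (ℝ × ℝ))) hB
  have hk : ∀ k : ℕ, ∀ᵐ τ ∂(volume.restrict (Ioo 0 T)),
      (k * Real.exp (-C * τ)) * ∫ x in Ioo (0 : ℝ) 1, a (x, τ) * u (x, τ) ^ 2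
      ≤ ∫ x in Ioo (0 : ℝ) 1, f (x, τ) * u (x, τ) := by
    intro k
    have he : ∀ t : ℝ, HasDerivAt (fun t => Real.exp (-C * t)) (Real.exp (-C * t) * -C) t :=
      fun t => (((hasDerivAt_id' t).const_mul (-C)).congr_deriv (mul_one _)).exp
    -- Solutions of `κ' = -C κ` and `P' = -2 κ P`; the parameter `k` is free.
    refine weighted_energy_le (κ := fun τ => k * Real.exp (-C * τ))
      (P := fun t => Real.exp (2 * k / C * Real.exp (-C * t))) (fun t => by positivity)
      (fun t => Real.exp_pos _) (fun t => ?_) (fun t => ?_) hf hg hu ham ha0 haA hac had hfg hug hD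
    · exact ((he t).const_mul (k : ℝ)).congr_deriv (by ring)
    · refine ((he t).const_mul (2 * k / C)).exp.congr_deriv ?_
      field_simp
  have hE0 : ∀ᵐ p ∂(volume.restrict (Ioo (0 : ℝ) 1 ×ˢ Ioo 0 T)), 0 ≤ a p * u p ^ 2 := by
    filter_upwards [hmem] with p hp using mul_nonneg (ha0 p hp).le (sq_nonneg _)
  have iau : Integrable (fun p => a p * u p ^ 2) (volume.restrict (Ioo 0 1 ×ˢ Ioo 0 T)) := by
    refine hu.integrable_sq.bdd_mul (c := A) ham ?_
    filter_upwards [hmem] with p hp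
    rw [Real.norm_of_nonneg (ha0 p hp).le]; exact haA p hp
  have hz : ∀ᵐ τ ∂(volume.restrict (Ioo 0 T)),
      ∫ x in Ioo (0 : ℝ) 1, a (x, τ) * u (x, τ) ^ 2 = 0 := by
    -- Only countably many `k` are used, so a single null set of times serves them all; a positive
    -- weighted norm would then contradict the bound for large `k`.
    filter_upwards [ae_all_iff.2 hk, ae_restrict_mem measurableSet_Ioo] with τ h hτ
    refine le_antisymm ?_ ?_
    · by_contra hpos
      rw [not_le] at hpos
      set E := ∫ x in Ioo (0 : ℝ) 1, a (x, τ) * u (x, τ) ^ 2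
      have hpos' : 0 < Real.exp (-C * τ) * E := mul_pos (Real.exp_pos _) hpos
      obtain ⟨n, hn⟩ := exists_nat_gt
        ((∫ x in Ioo (0 : ℝ) 1, f (x, τ) * u (x, τ)) / (Real.exp (-C * τ) * E))
      rw [div_lt_iff₀ hpos'] at hn
      have := h n
      rw [mul_assoc] at this
      linarith
    · refine setIntegral_nonneg measurableSet_Ioo fun x hx => ?_
      exact mul_nonneg (ha0 (x, τ) ⟨hx, hτ⟩).le (sq_nonneg _)
  have hzero : ∫ p in Ioo (0 : ℝ) 1 ×ˢ Ioo 0 T, a p * u p ^ 2 = 0 := by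
    rw [volume_restrict_prod] at iau ⊢
    rw [integral_prod_symm _ iau, integral_congr_ae hz]
    simp
  have := (integral_eq_zero_iff_of_nonneg_ae hE0 iau).1 hzero
  filter_upwards [this, hmem] with p h1 h2
  have h3 : a p * u p ^ 2 = 0 := h1
  simpa using (mul_eq_zero.1 h3).resolve_left (ha0 p h2).ne'

/-! ### Symmetry of kernel operators -/

/-- Functions given by a symmetric bounded kernel pair symmetrically. -/
lemma setIntegral_mul_symm_of_kernel {k : ℝ × ℝ → ℝ} {M : ℝ} {I : Set ℝ} (hI : MeasurableSet I)
    (hk : Measurable k) (hks : ∀ x y, k (x, y) = k (y, x))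
    (hkM : ∀ x ∈ I, ∀ y ∈ I, ‖k (x, y)‖ ≤ M) {f₁ f₂ u₁ u₂ : ℝ → ℝ}
    (hf₁ : IntegrableOn f₁ I) (hf₂ : IntegrableOn f₂ I)
    (hu₁ : ∀ᵐ x ∂(volume.restrict I), u₁ x = ∫ y in I, k (x, y) * f₁ y)
    (hu₂ : ∀ᵐ x ∂(volume.restrict I), u₂ x = ∫ y in I, k (x, y) * f₂ y) :
    ∫ x in I, f₁ x * u₂ x = ∫ x in I, f₂ x * u₁ x := by
  have hmem : ∀ᵐ x ∂(volume.restrict I), x ∈ I := ae_restrict_mem hI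
  have hi : Integrable (fun p : ℝ × ℝ => k p * (f₁ p.1 * f₂ p.2))
      ((volume.restrict I).prod (volume.restrict I)) := by
    refine (hf₁.mul_prod hf₂).bdd_mul (c := M) hk.aestronglyMeasurable ?_
    filter_upwards [Measure.quasiMeasurePreserving_fst.ae hmem,
      Measure.quasiMeasurePreserving_snd.ae hmem] with p h1 h2 using hkM _ h1 _ h2
  have e1 : ∫ x in I, f₁ x * u₂ x = ∫ x in I, ∫ y in I, k (x, y) * (f₁ x * f₂ y) := by
    refine integral_congr_ae ?_
    filter_upwards [hu₂] with x hx
    rw [hx, ← integral_const_mul]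
    congr 1 with y; ring
  have e2 : ∫ x in I, f₂ x * u₁ x = ∫ x in I, ∫ y in I, k (y, x) * (f₁ y * f₂ x) := by
    refine integral_congr_ae ?_
    filter_upwards [hu₁] with x hx
    rw [hx, ← integral_const_mul]
    congr 1 with y; rw [hks x y]; ring
  rw [e1, e2]
  exact integral_integral_swap hi

/-! ### Weak derivatives and product test functions -/

namespace BackwardParabolic

lemma locallyIntegrableOn_congr {E : Type*} [NormedAddCommGroup E] [MeasureSpace E] {Ω : Set E}
    {u u' : E → ℝ} (hu : LocallyIntegrableOn u Ω)
    (h : u =ᵐ[volume.restrict Ω] u') : LocallyIntegrableOn u' Ω := by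
  intro x hx
  obtain ⟨s, hs, his⟩ := hu x hx
  refine ⟨s ∩ Ω, Filter.inter_mem hs self_mem_nhdsWithin, ?_⟩
  exact (his.mono_set inter_subset_left).congr
    (ae_mono (Measure.restrict_mono inter_subset_right le_rfl) h)

section Sobolev

variable {E : Type*} [NormedAddCommGroup E] [NormedSpace ℝ E] [MeasureSpace E]
  {Ω : Set E} {e : E} {u u' g g' : E → ℝ}

lemma integrable_mul_of_tsupport_subset [BorelSpace E] [FiniteDimensional ℝ E] (hΩ : IsOpen Ω)
    (hu : LocallyIntegrableOn u Ω) {φ : E → ℝ} (hφ : Continuous φ) (hφc : HasCompactSupport φ)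
    (hφs : tsupport φ ⊆ Ω) : IntegrableOn (fun x => u x * φ x) Ω := by
  have h1 : IntegrableOn (fun x => u x * φ x) (tsupport φ) :=
    (hu.integrableOn_compact_subset hφs hφc).mul_continuousOn hφ.continuousOn hφc
  refine IntegrableOn.of_forall_sdiff_eq_zero h1 hΩ.measurableSet fun x hx => ?_
  simp [image_eq_zero_of_notMem_tsupport hx.2]

lemma HasWeakDeriv.sub [BorelSpace E] [FiniteDimensional ℝ E] (hΩ : IsOpen Ω)
    (h : HasWeakDeriv Ω e u g) (h' : HasWeakDeriv Ω e u' g') :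
    HasWeakDeriv Ω e (u - u') (g - g') := by
  refine ⟨h.1.sub h'.1, h.2.1.sub h'.2.1, fun φ hφ hφc hφs => ?_⟩
  have hd : Continuous fun x => fderiv ℝ φ x e :=
    (hφ.continuous_fderiv (by simp)).clm_apply continuous_const
  have hdc : HasCompactSupport fun x => fderiv ℝ φ x e := hφc.fderiv_apply ℝ e
  have hds : tsupport (fun x => fderiv ℝ φ x e) ⊆ Ω :=
    (tsupport_fderiv_apply_subset ℝ e).trans hφs
  simp only [Pi.sub_apply, sub_mul]
  rw [integral_sub (integrable_mul_of_tsupport_subset hΩ h.1 hd hdc hds)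
    (integrable_mul_of_tsupport_subset hΩ h'.1 hd hdc hds),
    integral_sub (integrable_mul_of_tsupport_subset hΩ h.2.1 hφ.continuous hφc hφs)
    (integrable_mul_of_tsupport_subset hΩ h'.2.1 hφ.continuous hφc hφs),
    h.2.2 φ hφ hφc hφs, h'.2.2 φ hφ hφc hφs]
  ring

lemma HasWeakDeriv.congr (h : HasWeakDeriv Ω e u g) (hu : u =ᵐ[volume.restrict Ω] u')
    (hg : g =ᵐ[volume.restrict Ω] g') : HasWeakDeriv Ω e u' g' := by
  refine ⟨locallyIntegrableOn_congr h.1 hu, locallyIntegrableOn_congr h.2.1 hg,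
    fun φ hφ hφc hφs => ?_⟩
  have e1 : ∫ x in Ω, u x * fderiv ℝ φ x e = ∫ x in Ω, u' x * fderiv ℝ φ x e :=
    integral_congr_ae (hu.mono fun x hx => by simp only [hx])
  have e2 : ∫ x in Ω, g x * φ x = ∫ x in Ω, g' x * φ x :=
    integral_congr_ae (hg.mono fun x hx => by simp only [hx])
  rw [← e1, h.2.2 φ hφ hφc hφs, e2]

lemma HasWeakDeriv.unique [BorelSpace E] [FiniteDimensional ℝ E] (hΩ : IsOpen Ω)
    (h : HasWeakDeriv Ω e u g) (h' : HasWeakDeriv Ω e u g') : g =ᵐ[volume.restrict Ω] g' := by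
  have := hΩ.ae_eq_zero_of_integral_contDiff_smul_eq_zero (μ := volume) (h.2.1.sub h'.2.1)
    fun φ hφ hφc hφs => by
      have e0 : ∫ x, φ x • (g - g') x = ∫ x in Ω, φ x • (g - g') x := by
        rw [setIntegral_eq_integral_of_forall_compl_eq_zero]
        intro x hx
        rw [image_eq_zero_of_notMem_tsupport fun hm => hx (hφs hm), zero_smul]
      have e1 : ∫ x in Ω, φ x • (g - g') x = (∫ x in Ω, g x * φ x) - ∫ x in Ω, g' x * φ x := by
        rw [← integral_sub (integrable_mul_of_tsupport_subset hΩ h.2.1 hφ.continuous hφc hφs)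
          (integrable_mul_of_tsupport_subset hΩ h'.2.1 hφ.continuous hφc hφs)]
        congr 1 with x
        simp only [Pi.sub_apply, smul_eq_mul]; ring
      have e2 := h.2.2 φ hφ hφc hφs
      have e3 := h'.2.2 φ hφ hφc hφs
      rw [e0, e1]
      linarith
  refine (ae_restrict_iff' hΩ.measurableSet).2 ?_
  filter_upwards [this] with x hx hxΩ
  exact sub_eq_zero.1 (hx hxΩ)

end Sobolev

lemma tsupport_prod_mul_subset (φ η : ℝ → ℝ) :
    tsupport (fun p : ℝ × ℝ => φ p.1 * η p.2) ⊆ tsupport φ ×ˢ tsupport η := by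
  refine closure_minimal (fun p hp => ?_) ((isClosed_tsupport φ).prod (isClosed_tsupport η))
  exact ⟨subset_tsupport φ (left_ne_zero_of_mul hp), subset_tsupport η (right_ne_zero_of_mul hp)⟩

lemma fderiv_prod_mul {φ η : ℝ → ℝ} (hφ : ContDiff ℝ ∞ φ) (hη : ContDiff ℝ ∞ η)
    (p : ℝ × ℝ) : fderiv ℝ (fun p : ℝ × ℝ => φ p.1 * η p.2) p (1, 0) = deriv φ p.1 * η p.2 ∧
      fderiv ℝ (fun p : ℝ × ℝ => φ p.1 * η p.2) p (0, 1) = φ p.1 * deriv η p.2 := by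
  have h1 : HasFDerivAt (fun p : ℝ × ℝ => φ p.1)
      (deriv φ p.1 • ContinuousLinearMap.fst ℝ ℝ ℝ) p :=
    ((hφ.differentiable (by simp) p.1).hasDerivAt).comp_hasFDerivAt p hasFDerivAt_fst
  have h2 : HasFDerivAt (fun p : ℝ × ℝ => η p.2)
      (deriv η p.2 • ContinuousLinearMap.snd ℝ ℝ ℝ) p :=
    ((hη.differentiable (by simp) p.2).hasDerivAt).comp_hasFDerivAt p hasFDerivAt_snd
  rw [(h1.fun_mul h2).fderiv]
  constructor <;> simp [mul_comm]

section Test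

variable {A B : Set ℝ} {u g : ℝ × ℝ → ℝ} {φ η : ℝ → ℝ}

lemma contDiff_prod_mul (hφ : ContDiff ℝ ∞ φ) (hη : ContDiff ℝ ∞ η) :
    ContDiff ℝ ∞ fun p : ℝ × ℝ => φ p.1 * η p.2 :=
  (hφ.comp contDiff_fst).mul (hη.comp contDiff_snd)

lemma hasCompactSupport_prod_mul (hφ : HasCompactSupport φ) (hη : HasCompactSupport η) :
    HasCompactSupport fun p : ℝ × ℝ => φ p.1 * η p.2 :=
  (hφ.prod hη).of_isClosed_subset (isClosed_tsupport _) (tsupport_prod_mul_subset φ η)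

lemma HasWeakDeriv.prod_mul_fst (h : HasWeakDeriv (A ×ˢ B) (1, 0) u g)
    (hφ : ContDiff ℝ ∞ φ) (hφc : HasCompactSupport φ) (hφs : tsupport φ ⊆ A)
    (hη : ContDiff ℝ ∞ η) (hηc : HasCompactSupport η) (hηs : tsupport η ⊆ B) :
    ∫ p in A ×ˢ B, u p * (deriv φ p.1 * η p.2) = - ∫ p in A ×ˢ B, g p * (φ p.1 * η p.2) := by
  rw [← h.2.2 _ (contDiff_prod_mul hφ hη) (hasCompactSupport_prod_mul hφc hηc)
    ((tsupport_prod_mul_subset φ η).trans (Set.prod_mono hφs hηs))]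
  congr 1 with p
  rw [(fderiv_prod_mul hφ hη p).1]

lemma HasWeakDeriv.prod_mul_snd (h : HasWeakDeriv (A ×ˢ B) (0, 1) u g)
    (hφ : ContDiff ℝ ∞ φ) (hφc : HasCompactSupport φ) (hφs : tsupport φ ⊆ A)
    (hη : ContDiff ℝ ∞ η) (hηc : HasCompactSupport η) (hηs : tsupport η ⊆ B) :
    ∫ p in A ×ˢ B, u p * (φ p.1 * deriv η p.2) = - ∫ p in A ×ˢ B, g p * (φ p.1 * η p.2) := by
  rw [← h.2.2 _ (contDiff_prod_mul hφ hη) (hasCompactSupport_prod_mul hφc hηc)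
    ((tsupport_prod_mul_subset φ η).trans (Set.prod_mono hφs hηs))]
  congr 1 with p
  rw [(fderiv_prod_mul hφ hη p).2]

lemma tsupport_deriv_subset_tsupport (φ : ℝ → ℝ) : tsupport (deriv φ) ⊆ tsupport φ :=
  closure_minimal support_deriv_subset (isClosed_tsupport φ)

end Test

end BackwardParabolic

/-! ### The homogeneous problem -/

namespace BackwardParabolic

variable {T : ℝ}

lemma isOpen_Q (T : ℝ) : IsOpen (Q T) := isOpen_Ioo.prod isOpen_Ioo

lemma measurableSet_Q (T : ℝ) : MeasurableSet (Q T) := (isOpen_Q T).measurableSet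

lemma volume_Q_lt_top (T : ℝ) : volume (Q T) < ⊤ := by
  rw [Q, Measure.volume_eq_prod, Measure.prod_prod]
  exact ENNReal.mul_lt_top (by simp) (by simp)

lemma HasBoundaryValue.sub {d v w g : ℝ × ℝ → ℝ} (hv : HasBoundaryValue T d v g)
    (hw : HasBoundaryValue T d w g) (hvm : AEStronglyMeasurable v (volume.restrict (Q T)))
    (hgm : AEStronglyMeasurable g (volume.restrict (Q T))) :
    Tendsto (fun h : ℝ => (ENNReal.ofReal h)⁻¹ * ∫⁻ p in {p | p ∈ Q T ∧ d p < h}, ‖v p - w p‖ₑ)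
      (𝓝[>] 0) (𝓝 0) := by
  unfold HasBoundaryValue at hv hw
  have h1 := hv.add hw
  rw [add_zero] at h1
  refine tendsto_of_tendsto_of_tendsto_of_le_of_le tendsto_const_nhds h1 (fun _ => zero_le)
    fun h => ?_
  simp only [← mul_add]
  gcongr
  have hm : AEMeasurable (fun p => ‖v p - g p‖ₑ)
      (volume.restrict {p | p ∈ Q T ∧ d p < h}) :=
    ((hvm.sub hgm).mono_measure (Measure.restrict_mono (fun p hp => hp.1) le_rfl)).enorm
  rw [← lintegral_add_left' hm]
  refine lintegral_mono fun p => ?_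
  have e : v p - w p = (v p - g p) - (w p - g p) := by ring
  rw [e]
  exact enorm_sub_le

/-- The derivatives in the equation are only locally integrable by definition. Uniqueness of weak
derivatives identifies them with the ones supplied by `MemH2`, which are square integrable. -/
lemma IsSolution.exists_weakDeriv {b : ℝ × ℝ → ℝ} {ψ₀ ψ₁ : ℝ → ℝ} {v : ℝ × ℝ → ℝ}
    (hv : IsSolution T b ψ₀ ψ₁ v) : ∃ vt vx vxx : ℝ × ℝ → ℝ,
    HasWeakDeriv (Q T) (0, 1) v vt ∧ HasWeakDeriv (Q T) (1, 0) v vx ∧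
    HasWeakDeriv (Q T) (1, 0) vx vxx ∧ MemLp vt 2 (volume.restrict (Q T)) ∧
    MemLp vxx 2 (volume.restrict (Q T)) ∧
    ∀ᵐ p ∂(volume.restrict (Q T)), vt p + b p * vxx p = 0 := by
  obtain ⟨vt, vx, vxx, h1, h2, h3, h4⟩ := hv.equation
  obtain ⟨gt, ht, htL, -⟩ := hv.memH2.2 (0, 1)
  obtain ⟨gx, hx, -, hxx⟩ := hv.memH2.2 (1, 0)
  obtain ⟨gxx, hxx, hxxL⟩ := hxx (1, 0)
  have e1 := ht.unique (isOpen_Q T) h1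
  have e2 := hx.unique (isOpen_Q T) h2
  have e3 := (hxx.congr e2 EventuallyEq.rfl).unique (isOpen_Q T) h3
  exact ⟨vt, vx, vxx, h1, h2, h3, htL.ae_eq e1, hxxL.ae_eq e3, h4⟩

lemma aestronglyMeasurable_comp_snd {ψ : ℝ → ℝ} (hψ : ContinuousOn ψ (Icc 0 T)) :
    AEStronglyMeasurable (fun p : ℝ × ℝ => ψ p.2) (volume.restrict (Q T)) := by
  refine ContinuousOn.aestronglyMeasurable ?_ (measurableSet_Q T)
  exact hψ.comp continuous_snd.continuousOn fun p hp => Ioo_subset_Icc_self hp.2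

/-- Uniqueness for the homogeneous problem. -/
lemma ae_eq_zero_of_homogeneous {b₀ b₁ : ℝ} (hb₀ : 0 < b₀) (hb₁ : 0 < b₁) {b : ℝ × ℝ → ℝ}
    (hT : 0 < T) (hb : C1NormLE T b b₁) (hb_lower : ∀ p ∈ Q T, b₀ ≤ b p)
    {u g ux f : ℝ × ℝ → ℝ}
    (hu0 : ∀ p ∉ Q T, u p = 0) (hg0 : ∀ p ∉ Q T, g p = 0) (hf0 : ∀ p ∉ Q T, f p = 0)
    (hu : MemLp u 2 volume) (hg : MemLp g 2 volume) (hf : MemLp f 2 volume)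
    (hut : HasWeakDeriv (Q T) (0, 1) u g) (hux : HasWeakDeriv (Q T) (1, 0) u ux)
    (huxx : HasWeakDeriv (Q T) (1, 0) ux (-f))
    (hfg : ∀ᵐ p ∂(volume.restrict (Q T)), g p - b p * f p = 0)
    (hl : Tendsto (fun h : ℝ => (ENNReal.ofReal h)⁻¹ *
      ∫⁻ p in {p | p ∈ Q T ∧ p.1 < h}, ‖u p‖ₑ) (𝓝[>] 0) (𝓝 0))
    (hr : Tendsto (fun h : ℝ => (ENNReal.ofReal h)⁻¹ *
      ∫⁻ p in {p | p ∈ Q T ∧ 1 - p.1 < h}, ‖u p‖ₑ) (𝓝[>] 0) (𝓝 0))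
    (hi : Tendsto (fun h : ℝ => (ENNReal.ofReal h)⁻¹ *
      ∫⁻ p in {p | p ∈ Q T ∧ p.2 < h}, ‖u p‖ₑ) (𝓝[>] 0) (𝓝 0)) :
    u =ᵐ[volume.restrict (Q T)] 0 := by
  have : IsFiniteMeasure ((volume : Measure (ℝ × ℝ)).restrict (Q T)) :=
    ⟨by simpa using volume_Q_lt_top T⟩
  have integ : ∀ {F : ℝ × ℝ → ℝ}, MemLp F 2 volume → IntegrableOn F (Q T) := fun hF =>
    (hF.restrict (Q T)).integrable (by norm_num)
  have integ' : ∀ {F : ℝ × ℝ → ℝ}, MemLp F 2 volume → (∀ p ∉ Q T, F p = 0) → Integrable F :=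
    fun hF hF0 => (integrableOn_iff_integrable_of_support_subset
      fun p hp => by_contra fun h => hp (hF0 p h)).1 (integ hF)
  have iu := integ hu
  have ig := integ hg
  have jf := integ hf
  -- space representation
  have hspace : ∀ᵐ p ∂(volume.restrict (Ioo 0 1 ×ˢ Ioo 0 T)),
      u p = ∫ y in Ioo 0 1, greenKernel (p.1, y) * f (y, p.2) := by
    refine ae_eq_greenKernel_integral iu jf (fun η hη hηc => ?_) (fun η hη hηc => ?_)
      fun φ η hφ hφc hφs hη hηc hηs => ?_
    · obtain ⟨C, hC⟩ := hηc.exists_bound_of_continuous hη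
      refine zeroMeanTrace_integral iu hC (hl.congr fun h => ?_)
      congr 3
      ext p
      simp only [Q, mem_ofPred_eq, mem_prod, mem_inter_iff, mem_Iio]
      tauto
    · obtain ⟨C, hC⟩ := hηc.exists_bound_of_continuous hη
      -- The side `x = 1` is carried to `x = 0` by reflection.
      have mp : MeasurePreserving (fun p : ℝ × ℝ => (1 - p.1, p.2)) volume volume :=
        (Measure.measurePreserving_sub_left volume (1 : ℝ)).prod
          (MeasurePreserving.id (volume : Measure ℝ))
      have me : MeasurableEmbedding (fun p : ℝ × ℝ => (1 - p.1, p.2)) :=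
        (MeasurableEquiv.subLeft (1 : ℝ)).measurableEmbedding.prodMap MeasurableEmbedding.id
      have hpre : (fun p : ℝ × ℝ => (1 - p.1, p.2)) ⁻¹' Q T = Ioo 0 1 ×ˢ Ioo 0 T := by
        ext p
        simp only [Q, mem_preimage, mem_prod, mem_Ioo]
        constructor <;> rintro ⟨⟨h1, h2⟩, h3⟩ <;> exact ⟨⟨by linarith, by linarith⟩, h3⟩
      have iu' : IntegrableOn (fun p : ℝ × ℝ => u (1 - p.1, p.2)) (Ioo 0 1 ×ˢ Ioo 0 T) := by
        rw [← hpre]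
        exact (mp.integrableOn_comp_preimage me).2 iu
      refine zeroMeanTrace_integral iu' hC (hr.congr fun h => ?_)
      congr 1
      rw [← mp.setLIntegral_comp_preimage_emb me]
      congr 2
      ext p
      simp only [Q, mem_preimage, mem_ofPred_eq, mem_prod, mem_inter_iff, mem_Iio, mem_Ioo]
      constructor
      · rintro ⟨⟨⟨h1, h2⟩, h3⟩, h4⟩
        exact ⟨⟨⟨by linarith, by linarith⟩, by linarith⟩, h3⟩
      · rintro ⟨⟨⟨h1, h2⟩, h4⟩, h3⟩
        exact ⟨⟨⟨by linarith, by linarith⟩, h3⟩, by linarith⟩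
    · have hφ' := (contDiff_infty_iff_deriv.1 hφ).2
      have e1 := hux.prod_mul_fst hφ' hφc.deriv ((tsupport_deriv_subset_tsupport φ).trans hφs)
        hη hηc hηs
      have e2 := huxx.prod_mul_fst hφ hφc hφs hη hηc hηs
      rw [e1, e2, neg_neg, ← integral_neg]
      congr 1 with p
      simp only [Pi.neg_apply]
      ring
  -- time representation
  have htime : ∀ᵐ p ∂(volume.restrict (Ioo (0 : ℝ) 1 ×ˢ Ioo 0 T)),
      u p = ∫ s in (0 : ℝ)..p.2, g (p.1, s) := by
    -- The coordinates are exchanged so that time becomes the first variable, the one on which the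
    -- kernel acts.
    have mp : MeasurePreserving (Prod.swap : ℝ × ℝ → ℝ × ℝ) volume volume :=
      Measure.measurePreserving_swap
    have me : MeasurableEmbedding (Prod.swap : ℝ × ℝ → ℝ × ℝ) :=
      MeasurableEquiv.prodComm.measurableEmbedding
    have hpre : (Prod.swap : ℝ × ℝ → ℝ × ℝ) ⁻¹' Q T = Ioo 0 T ×ˢ Ioo 0 1 := by
      rw [Q, preimage_swap_prod]
    have hswap : ∀ F : ℝ × ℝ → ℝ, ∫ p in Ioo 0 T ×ˢ Ioo 0 1, F p.swap = ∫ p in Q T, F p := by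
      intro F
      rw [← hpre]
      exact mp.setIntegral_preimage_emb me F (Q T)
    have sint : ∀ {F : ℝ × ℝ → ℝ}, IntegrableOn F (Q T) →
        IntegrableOn (fun p : ℝ × ℝ => F p.swap) (Ioo 0 T ×ˢ Ioo 0 1) := by
      intro F hF
      rw [← hpre]
      exact (mp.integrableOn_comp_preimage me).2 hF
    have h := ae_eq_primitiveKernel_integral (u := fun p => u p.swap) (g := fun p => g p.swap)
      (T := T) (a := 0) (b := 1) (sint iu) (sint ig) (fun η hη hηc => ?_)
      fun η φ hη hηc hηs hφ hφc hφs => ?_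
    · have mpr : MeasurePreserving (Prod.swap : ℝ × ℝ → ℝ × ℝ)
          (volume.restrict (Ioo 0 1 ×ˢ Ioo 0 T)) (volume.restrict (Ioo 0 T ×ˢ Ioo 0 1)) := by
        rw [volume_restrict_prod, volume_restrict_prod]
        exact Measure.measurePreserving_swap
      filter_upwards [mpr.quasiMeasurePreserving.ae h,
        ae_restrict_mem (measurableSet_Ioo.prod measurableSet_Ioo)] with p hp hpm
      rw [Prod.swap_swap] at hp
      rw [hp, intervalIntegral.integral_of_le hpm.2.1.le]
      have : (fun s => primitiveKernel (p.swap.1, s) * g (s, p.swap.2).swap)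
          = (Iio p.2).indicator fun s => g (p.1, s) := by
        ext s
        by_cases hs : s < p.2 <;> simp [primitiveKernel, indicator, hs]
      rw [this, setIntegral_indicator measurableSet_Iio, integral_Ioc_eq_integral_Ioo]
      congr 2
      ext s
      simp only [mem_inter_iff, mem_Ioo, mem_Iio]
      exact ⟨fun h => ⟨h.1.1, h.2⟩, fun h => ⟨⟨h.1, h.2.trans hpm.2.2⟩, h.2⟩⟩
    · obtain ⟨C, hC⟩ := hηc.exists_bound_of_continuous hη
      refine zeroMeanTrace_integral (sint iu) hC (hi.congr fun h => ?_)
      congr 1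
      rw [← mp.setLIntegral_comp_preimage_emb me]
      congr 2
      ext p
      simp only [Q, mem_preimage, mem_ofPred_eq, mem_prod, mem_inter_iff, mem_Iio, Prod.fst_swap,
        Prod.snd_swap]
      tauto
    · have e1 := hut.prod_mul_snd hφ hφc hφs hη hηc hηs
      refine (hswap fun p => u p * (deriv η p.2 * φ p.1)).trans (Eq.trans ?_
        (congrArg Neg.neg (hswap fun p => g p * (η p.2 * φ p.1)).symm))
      simp only [mul_comm (deriv η _), mul_comm (η _)]
      exact e1
  -- slices
  have slice : ∀ {p : ℝ × ℝ → Prop}, (∀ᵐ z ∂(volume.restrict (Ioo (0 : ℝ) 1 ×ˢ Ioo 0 T)), p z) →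
      ∀ᵐ t ∂(volume.restrict (Ioo 0 T)), ∀ᵐ x ∂(volume.restrict (Ioo (0 : ℝ) 1)), p (x, t) := by
    intro p hp
    rw [volume_restrict_prod] at hp
    exact Measure.ae_ae_of_ae_prod
      ((Measure.measurePreserving_swap (μ := volume.restrict (Ioo 0 T))
        (ν := volume.restrict (Ioo (0 : ℝ) 1))).quasiMeasurePreserving.ae hp)
  have gint : Integrable g ((volume : Measure ℝ).prod volume) := integ' hg hg0
  have fint : Integrable f ((volume : Measure ℝ).prod volume) := integ' hf hf0
  have hxout : ∀ (F G : ℝ × ℝ → ℝ) (t s : ℝ), (∀ p ∉ Q T, F p = 0) →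
      ∫ x in Ioo (0 : ℝ) 1, F (x, t) * G (x, s) = ∫ x, F (x, t) * G (x, s) := by
    intro F G t s hF
    refine setIntegral_eq_integral_of_forall_compl_eq_zero fun x hx => ?_
    rw [hF (x, t) fun h => hx h.1, zero_mul]
  -- Extension by zero places everything on the whole plane, where time translations make sense. For
  -- `t ≤ 0` all terms vanish. The primitive relation is claimed only for `t < T`, since beyond `T`
  -- the extended `u` is zero but the integral of `g` need not be.
  have energy := ae_integral_mul_eq_of_symmetric (T := T) hf hg hu gint.prod_right_ae
    (G := {t | Integrable (fun x => f (x, t)) ∧ ∀ᵐ x ∂(volume.restrict (Ioo (0 : ℝ) 1)),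
      u (x, t) = ∫ y in Ioo (0 : ℝ) 1, greenKernel (x, y) * f (y, t)}) ?_ ?_ ?_
  rotate_left
  · filter_upwards [(ae_restrict_iff' measurableSet_Ioo).1 (slice htime)] with t ht htT
    rcases le_or_gt t 0 with h0 | h0
    · refine Eventually.of_forall fun x => ?_
      rw [hu0 (x, t) fun h => h0.not_gt h.2.1]
      refine (setIntegral_eq_zero_of_forall_eq_zero fun s hs => ?_).symm
      exact hg0 (x, s) fun h => (le_trans hs h0).not_gt h.2.1
    · filter_upwards [(ae_restrict_iff' measurableSet_Ioo).1 (ht ⟨h0, htT⟩)] with x hx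
      by_cases hxm : x ∈ Ioo (0 : ℝ) 1
      · have hx' : u (x, t) = ∫ s in (0 : ℝ)..t, g (x, s) := hx hxm
        rw [hx', intervalIntegral.integral_of_le h0.le]
        refine setIntegral_eq_of_subset_of_forall_sdiff_eq_zero measurableSet_Iic
          (fun s hs => hs.2) (fun s hs => ?_) |>.symm
        exact hg0 (x, s) fun h => hs.2 ⟨h.2.1, hs.1⟩
      · rw [hu0 (x, t) fun h => hxm h.1]
        refine (setIntegral_eq_zero_of_forall_eq_zero fun s hs => ?_).symm
        exact hg0 (x, s) fun h => hxm h.1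
  · filter_upwards [(ae_restrict_iff' measurableSet_Ioo).1 (slice hspace), fint.prod_left_ae]
      with t ht hft htT
    refine ⟨hft, ?_⟩
    rcases le_or_gt t 0 with h0 | h0
    · refine Eventually.of_forall fun x => ?_
      rw [hu0 (x, t) fun h => h0.not_gt h.2.1]
      refine (setIntegral_eq_zero_of_forall_eq_zero fun y hy => ?_).symm
      rw [hf0 (y, t) fun h => h0.not_gt h.2.1, mul_zero]
    · exact ht ⟨h0, htT⟩
  · rintro s ⟨s1, s2⟩ t ⟨t1, t2⟩
    rw [← hxout f u s t hf0, ← hxout f u t s hf0]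
    exact setIntegral_mul_symm_of_kernel (M := 1) measurableSet_Ioo
      continuous_greenKernel.measurable greenKernel_swap
      (fun x hx y hy => norm_greenKernel_le hx hy) s1.integrableOn t1.integrableOn s2 t2
  -- the coefficient
  have hQbar : Qbar T = closure (Q T) := by
    rw [Q, closure_prod_eq, closure_Ioo zero_ne_one, closure_Ioo hT.ne, Qbar]
  have hbc : ContinuousOn b (Qbar T) := hb.1.continuousOn
  -- The lower bound extends to the closed rectangle by continuity; it is needed at `t = 0`, where
  -- the absolute continuity of `1 / b` starts.
  have hbl : ∀ p ∈ Qbar T, b₀ ≤ b p := fun p hp => by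
    rw [hQbar] at hp hbc
    exact le_on_closure hb_lower continuousOn_const hbc hp
  have hsub : Q T ⊆ Qbar T := by rw [hQbar]; exact subset_closure
  have hbpos : ∀ p ∈ Qbar T, 0 < b p := fun p hp => hb₀.trans_le (hbl p hp)
  -- The constant comes from `a_t = -b_t / b² ≤ b₁ / b² ≤ (b₁ / b₀) a`.
  refine ae_eq_zero_of_energy (a := fun p => (b p)⁻¹) (C := b₁ / b₀) (A := b₀⁻¹) (by positivity)
    (hf.restrict _) (hg.restrict _) (hu.restrict _) ?_ (fun p hp => inv_pos.2 (hbpos p (hsub hp)))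
    (fun p hp => inv_anti₀ hb₀ (hb_lower p hp)) ?_ ?_ ?_ htime ?_
  · exact ((hbc.mono hsub).inv₀ fun p hp => (hbpos p (hsub hp)).ne').aestronglyMeasurable
      (measurableSet_Q T)
  · intro x hx τ hτ
    refine ContDiffOn.absolutelyContinuousOnInterval ?_
    rw [uIcc_of_le hτ.1.le]
    have hmap : ∀ t ∈ Icc 0 τ, (x, t) ∈ Qbar T := fun t ht =>
      ⟨Ioo_subset_Icc_self hx, ht.1, ht.2.trans hτ.2.le⟩
    refine ContDiffOn.inv ?_ fun t ht => (hbpos _ (hmap t ht)).ne'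
    exact hb.1.comp (contDiff_const.prodMk contDiff_id).contDiffOn hmap
  · intro x hx t ht
    have hp : (x, t) ∈ Q T := ⟨hx, ht⟩
    have hnhds : Qbar T ∈ 𝓝 (x, t) := Filter.mem_of_superset ((isOpen_Q T).mem_nhds hp) hsub
    have hfd : HasFDerivAt b (fderivWithin ℝ b (Qbar T) (x, t)) (x, t) :=
      ((hb.1.differentiableOn (by simp) _ (hsub hp)).hasFDerivWithinAt).hasFDerivAt hnhds
    have hd : HasDerivAt (fun t => b (x, t)) (fderivWithin ℝ b (Qbar T) (x, t) (0, 1)) t :=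
      hfd.comp_hasDerivAt t ((hasDerivAt_const t x).prodMk (hasDerivAt_id t))
    have hbp := hbpos _ (hsub hp)
    have hd' := hd.inv hbp.ne'
    have e : deriv (fun t => (b (x, t))⁻¹) t
        = -(fderivWithin ℝ b (Qbar T) (x, t) (0, 1)) / b (x, t) ^ 2 := hd'.deriv
    rw [e]
    have h1 : -(fderivWithin ℝ b (Qbar T) (x, t) (0, 1)) ≤ b₁ :=
      (neg_le_abs _).trans (hb.2 _ (hsub hp)).2.2
    rw [← div_eq_mul_inv, div_div, div_le_div_iff₀ (by positivity) (by positivity)]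
    have h2 := hbl _ (hsub hp)
    calc -(fderivWithin ℝ b (Qbar T) (x, t) (0, 1)) * (b₀ * b (x, t))
        ≤ b₁ * (b₀ * b (x, t)) := mul_le_mul_of_nonneg_right h1 (by positivity)
      _ ≤ b₁ * (b (x, t) * b (x, t)) := by gcongr
      _ = b₁ * b (x, t) ^ 2 := by ring
  · filter_upwards [hfg, ae_restrict_mem (measurableSet_Q T)] with p h1 h2
    have := (hbpos p (hsub h2)).ne'
    rw [eq_inv_mul_iff_mul_eq₀ this]
    linarith
  · filter_upwards [energy] with τ hτ hτm
    rw [hxout f u τ τ hf0, hτ hτm.2, intervalIntegral.integral_of_le hτm.1.le]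
    have e : ∀ t, ∫ x in Ioo (0 : ℝ) 1, 2 * (f (x, t) * g (x, t))
        = ∫ x, 2 * (f (x, t) * g (x, t)) := fun t => by
      rw [integral_const_mul, integral_const_mul, hxout f g t t hf0]
    simp only [e]
    refine setIntegral_eq_of_subset_of_forall_sdiff_eq_zero measurableSet_Iic
      (fun s hs => hs.2) (fun s hs => ?_)
    have : ∀ x, 2 * (f (x, s) * g (x, s)) = 0 := fun x => by
      rw [hf0 (x, s) fun h => hs.2 ⟨h.2.1, hs.1⟩]; ring
    simp [this]

end BackwardParabolic

/-! ### Uniqueness for the original problem -/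

open BackwardParabolic in
theorem corollary4p1 (T : ℝ) (hT : 0 < T) (b₀ b₁ : ℝ) (hb₀ : 0 < b₀) (hb₀₁ : b₀ < b₁)
    (b : ℝ × ℝ → ℝ) (hb : BackwardParabolic.C1NormLE T b b₁)
    (hb_lower : ∀ p ∈ BackwardParabolic.Q T, b₀ ≤ b p)
    (ψ₀ ψ₁ : ℝ → ℝ) (hψ₀ : BackwardParabolic.IsBoundaryDatum T ψ₀)
    (hψ₁ : BackwardParabolic.IsBoundaryDatum T ψ₁)
    (v w : ℝ × ℝ → ℝ) (hv : BackwardParabolic.IsSolution T b ψ₀ ψ₁ v)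
    (hw : BackwardParabolic.IsSolution T b ψ₀ ψ₁ w) :
    v =ᵐ[volume.restrict (BackwardParabolic.Q T)] w := by
  obtain ⟨vt, vx, vxx, v1, v2, v3, v4, v5, v6⟩ := hv.exists_weakDeriv
  obtain ⟨wt, wx, wxx, w1, w2, w3, w4, w5, w6⟩ := hw.exists_weakDeriv
  have hQ := measurableSet_Q T
  have ind : ∀ F : ℝ × ℝ → ℝ, F =ᵐ[volume.restrict (Q T)] (Q T).indicator F := fun F =>
    (indicator_ae_eq_restrict hQ).symm
  have vm := hv.memH2.1.aestronglyMeasurable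
  have tr : ∀ {d g : ℝ × ℝ → ℝ}, HasBoundaryValue T d v g → HasBoundaryValue T d w g →
      AEStronglyMeasurable g (volume.restrict (Q T)) →
      Tendsto (fun h : ℝ => (ENNReal.ofReal h)⁻¹ *
        ∫⁻ p in {p | p ∈ Q T ∧ d p < h}, ‖(Q T).indicator (v - w) p‖ₑ) (𝓝[>] 0) (𝓝 0) := by
    intro d g h1 h2 h3
    refine (h1.sub h2 vm h3).congr fun h => ?_
    congr 1
    refine lintegral_congr_ae ?_
    filter_upwards [ae_mono (Measure.restrict_mono (fun p hp => hp.1) le_rfl) (ind (v - w))]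
      with p hp
    rw [← hp, Pi.sub_apply]
  -- The difference of the solutions and its derivatives are set to zero outside the rectangle,
  -- which changes nothing almost everywhere inside. The sign in `f` makes it `-u_xx`, so that `u`
  -- is the Green operator applied to `f`.
  have key := ae_eq_zero_of_homogeneous (T := T) (b := b) hb₀ (hb₀.trans hb₀₁) hT hb hb_lower
    (u := (Q T).indicator (v - w)) (g := (Q T).indicator (vt - wt)) (ux := vx - wx)
    (f := (Q T).indicator (-(vxx - wxx)))
    (fun p hp => indicator_of_notMem hp _) (fun p hp => indicator_of_notMem hp _)
    (fun p hp => indicator_of_notMem hp _)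
    ((memLp_indicator_iff_restrict hQ).2 (hv.memH2.1.sub hw.memH2.1))
    ((memLp_indicator_iff_restrict hQ).2 (v4.sub w4))
    ((memLp_indicator_iff_restrict hQ).2 (v5.sub w5).neg)
    ((v1.sub (isOpen_Q T) w1).congr (ind _) (ind _))
    ((v2.sub (isOpen_Q T) w2).congr (ind _) EventuallyEq.rfl)
    ((v3.sub (isOpen_Q T) w3).congr EventuallyEq.rfl ?_) ?_
    (tr hv.left hw.left (aestronglyMeasurable_comp_snd hψ₀.2))
    (tr hv.right hw.right (aestronglyMeasurable_comp_snd hψ₁.2))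
    (tr hv.initial hw.initial (Continuous.aestronglyMeasurable (by fun_prop)))
  · filter_upwards [key, ind (v - w)] with p h1 h2
    rw [← h2] at h1
    exact sub_eq_zero.1 h1
  · filter_upwards [ind (-(vxx - wxx))] with p hp
    rw [Pi.neg_apply, ← hp, Pi.neg_apply, neg_neg]
  · filter_upwards [ind (vt - wt), ind (-(vxx - wxx)), v6, w6] with p h1 h2 h3 h4
    rw [← h1, ← h2]
    simp only [Pi.sub_apply, Pi.neg_apply]
    linarith
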